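/- Conventions. "Computable in polynomial time" refers to Turing machines whose number of steps is bounded by a polynomial in the length of the binary input word; integers are output in binary, a number written in unary is the word $1^n$, and a pair $(n,k)\in\mathbb{N}\times\mathbb{Z}$ is input as $1^n\,0\,\mathrm{bin}(k)$, so that the time is polynomial in $n+\log|k|$. $\mathsf{FP}_1$ is the class of functions $\varphi:\mathbb{N}\to\mathbb{N}$ such that $1^n\mapsto\varphi(n)$ (in binary) is computable in polynomial time. $\#\mathsf{P}_1$ is the class of functions of the form $\varphi(n)=\#\{w\in\{0,1\}^*: |w|\le p(n),\ 1^n\,0\,w\in P\}$ with a polynomial $p$ and a language $P\in\mathsf{P}$. For $f\in L^2[0,1]$ (complex-valued), let $\tilde f_k=\int_0^1 e^{-2\pi i k t}f(t)\,dt$ for $k\in\mathbb{Z}$, and $\hat f_{S,s}=S\int_{s/S}^{(s+1)/S}f(t)\,dt$ for $0\le s<S$. Call $f$ \emph{Fourier-computable in polynomial time} if (i) there are Gaussian integers $c_{k,n}$ ($k\in\mathbb{Z}$, $n\in\mathbb{N}$) with $|\tilde f_k-c_{k,n}/2^n|\le 2^{-n}$ such that (ii) $(n,k)\mapsto\operatorname{Re}c_{k,n}$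 and $(n,k)\mapsto\operatorname{Im}c_{k,n}$ are computable in time polynomial in $n+\log|k|$, and (iii) there is a polynomial $p$ such that for all $m\in\mathbb{N}$, with $K=2^{p(m)}$, $\big\|f-\sum_{|k|\le K}\tilde f_k e^{2\pi i k t}\big\|_2\le 2^{-m}$. Theorem. There exists a function $f\in L^2[0,1]$ which is Fourier-computable in polynomial time, but such that, unless $\#\mathsf{P}_1\subseteq\mathsf{FP}_1$, its first step averages $\hat f_{S(n),0}$ with $S(n)=2^{n^2+n}$ are not computable in polynomial time: there is no sequence $(h_n)_{n\in\mathbb{N}}$ of Gaussian integers with $|\hat f_{S(n),0}-h_n/2^n|\le 2^{-n}$ for all $n$ for which $1^n\mapsto\operatorname{Re}h_n$ and $1^n\mapsto\operatorname{Im}h_n$ are computable in time polynomial in $n$. -/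

import Mathlib

open MeasureTheory

noncomputable section

namespace FourierStep

/-! ### Polynomial-time computation -/

/-- `F` is computable in time polynomial in the length of the encoded input, by a (multi-stack)
Turing machine in the sense of Mathlib. -/
def PolyTime {α β : Type} (ea : α → List Bool) (eb : β → List Bool) (F : α → β) : Prop :=
  Nonempty (Turing.TM2ComputableInPolyTime ea eb F)

/-- Binary encoding of an integer: a sign bit followed by the binary digits of `|z|`. -/
def encodeInt (z : ℤ) : List Bool :=
  decide (z < 0) :: Computability.encodeNat z.natAbs

/-- The word `1ⁿ 0 w`, pairing the number `n` (in unary) with the word `w`. -/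
def unaryPair (n : ℕ) (w : List Bool) : List Bool :=
  Computability.unaryEncodeNat n ++ false :: w

/-- The word `1ⁿ 0 bin(k)`, whose length is `n + log |k|` up to an additive constant. -/
def encodeNatInt (a : ℕ × ℤ) : List Bool :=
  unaryPair a.1 (encodeInt a.2)

/-- The class `P` of languages over `{0,1}` decidable in polynomial time. -/
def classP : Set (Set (List Bool)) :=
  {L | ∃ χ : List Bool → Bool, (∀ x, x ∈ L ↔ χ x = true) ∧ PolyTime id Computability.encodeBool χ}

/-- The class `FP₁`: functions computable in polynomial time, input in unary, output in binary. -/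
def classFP1 : Set (ℕ → ℕ) :=
  {φ | PolyTime Computability.unaryEncodeNat Computability.encodeNat φ}

/-- The class `#P₁`: functions counting, on unary input `1ⁿ`, the witnesses of length at most
polynomial in `n` accepted by a polynomial-time predicate. -/
def classSharpP1 : Set (ℕ → ℕ) :=
  {φ | ∃ P ∈ classP, ∃ p : Polynomial ℕ, ∀ n : ℕ,
    φ n = Set.ncard {w : List Bool | w.length ≤ p.eval n ∧ unaryPair n w ∈ P}}

/-! ### Square-integrable functions on the unit interval -/

/-- Lebesgue measure on `[0,1]`. -/
abbrev unitMeasure : Measure ℝ := volume.restrict (Set.Icc (0 : ℝ) 1)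

/-- The space `L²[0,1]` of complex-valued square-integrable functions. -/
abbrev L2Unit : Type := Lp ℂ 2 unitMeasure

/-- The `k`-th Fourier coefficient `∫₀¹ exp(-2πikt) f(t) dt`. -/
def fourierCoeff (f : L2Unit) (k : ℤ) : ℂ :=
  ∫ t, Complex.exp (-(2 * Real.pi * Complex.I * k * t)) * f t ∂unitMeasure

/-- The partial sum `∑_{|k| ≤ K} f̃ₖ exp(2πikt)` of the Fourier series. -/
def fourierPartialSum (f : L2Unit) (K : ℕ) (t : ℝ) : ℂ :=
  ∑ k ∈ Finset.Icc (-(K : ℤ)) K, fourierCoeff f k * Complex.exp (2 * Real.pi * Complex.I * k * t)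

/-- The average `S · ∫_{s/S}^{(s+1)/S} f(t) dt` of `f` over the `s`-th of `S` equal steps. -/
def stepAverage (f : L2Unit) (S s : ℕ) : ℂ :=
  S * ∫ t in ((s : ℝ) / S)..((s + 1 : ℝ) / S), f t

/-- `f ∈ L²[0,1]` is Fourier-computable in polynomial time. -/
def FourierPolyTime (f : L2Unit) : Prop :=
  (∃ c : ℤ → ℕ → GaussianInt,
    (∀ (k : ℤ) (n : ℕ), ‖fourierCoeff f k - (c k n : ℂ) / 2 ^ n‖ ≤ (2 ^ n : ℝ)⁻¹) ∧
    PolyTime encodeNatInt encodeInt (fun a : ℕ × ℤ => (c a.2 a.1).re) ∧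
    PolyTime encodeNatInt encodeInt (fun a : ℕ × ℤ => (c a.2 a.1).im)) ∧
  ∃ p : Polynomial ℕ, ∀ m : ℕ,
    eLpNorm (fun t => f t - fourierPartialSum f (2 ^ p.eval m) t) 2 unitMeasure
      ≤ ENNReal.ofReal (2 ^ m : ℝ)⁻¹

/-- The first step averages `f̂_{S(n),0}`, for the step counts `S(0), S(1), …`, are computable in
polynomial time: on input `1ⁿ` a Gaussian integer `hₙ` with `|f̂_{S(n),0} - hₙ/2ⁿ| ≤ 2⁻ⁿ` is
produced in time polynomial in `n`. Only precision `n` is asked for at step count `S(n)`, so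
that the negation of this property also excludes algorithms which approximate `f̂_{S(N),0}` to
every precision `2⁻ⁿ`, in time polynomial in `n + log S(N)` where `log S(N)` is polynomial. -/
def FirstStepPolyTime (f : L2Unit) (S : ℕ → ℕ) : Prop :=
  ∃ h : ℕ → GaussianInt,
    (∀ n : ℕ, ‖stepAverage f (S n) 0 - (h n : ℂ) / 2 ^ n‖ ≤ (2 ^ n : ℝ)⁻¹) ∧
    PolyTime Computability.unaryEncodeNat encodeInt (fun n => (h n).re) ∧
    PolyTime Computability.unaryEncodeNat encodeInt (fun n => (h n).im)

end FourierStep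

end

open MeasureTheory

noncomputable section

namespace FourierStep

open Turing

/-! If #P₁ ⊆ FP₁, the lower bound is vacuous and any Fourier-computable function serves. Otherwise
fix a single φ in #P₁ outside FP₁, with verifier χ and length bound p; no complete function is
needed. Put f(t) = ∑ₘ 2^(-D(m)) ∑_w exp(2πi freq(m,w) t), where w is either empty or b w' with b a
free bit and w' a witness for m. The binary digits of freq(m,w) spell out m and w, so one Fourier
coefficient costs one parse of k and one run of χ. An average over a short interval at 0, by
contrast, adds up all coefficients of a block, and so counts witnesses.

The scales are as follows. Frequencies of block m are divisible by 2^(D(m)(D(m)+1)) and have only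
about m + p(m) further digits. Take N = D(m)+1 and S = 2^(N²+N) = 2^((D(m)+1)(D(m)+2)). Later
frequencies are multiples of S, and their averages vanish exactly (`average_char_freq_eq_zero`).
Frequencies of blocks up to m are tiny compared with S, and their averages are nearly 1
(`norm_average_char_sub_one_le`). Hence the average is within 2^(-N)/2 of ∑_{i≤m} 2^(-D(i))
(2φ(i)+1) (`norm_stepAverage_sub_le`). Since D grows fast, 2^N times this sum is 4(φ(m) + 2^(p(m)+1)
y) + 2 (`exists_sum_blockMass_eq`). An approximation with error 2^(-N) gives an integer off by at
most 1, so its quotient by 4, reduced modulo 2^(p(m)+1), is φ(m).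

The machine side needs two explicit algorithms, `polyTime_coeffApprox` and `polyTime_extract`. They
are written in a small stack language with calls to one given machine; `Run.reach` and
`polyTime_of_run` turn its timed semantics into Turing machines. -/

/-! ### Stack programs calling a Turing machine -/

/-- Structured programs acting on stacks of bits indexed by `R`. The instruction `call r r'` feeds
the reversed contents of `r` to a fixed Turing machine and pushes the output onto `r'`. -/
inductive Prog (R : Type) : Type
  | skip
  | push (r : R) (b : Bool)
  | seq (p q : Prog R)
  | case (r : R) (body : Option Bool → Prog R)
  | loop (r : R) (cont : Bool → Bool) (body : Bool → Prog R)
  | call (r r' : R)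

namespace Prog

variable {R : Type}

/-- The labels of the Turing machine fragment which implements a program. -/
def Lab (Λ : Type) : Prog R → Type
  | skip => Unit
  | push _ _ => Unit
  | seq p q => p.Lab Λ ⊕ q.Lab Λ
  | case _ body => Option (Σ o, (body o).Lab Λ)
  | loop _ _ body => Option (Σ b, (body b).Lab Λ)
  | call _ _ => Bool ⊕ Λ

/-- There are finitely many labels. -/
@[reducible]
def labFintype (Λ : Type) [Fintype Λ] : (p : Prog R) → Fintype (p.Lab Λ)
  | skip => inferInstanceAs (Fintype Unit)
  | push _ _ => inferInstanceAs (Fintype Unit)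
  | seq p q =>
    haveI := labFintype Λ p
    haveI := labFintype Λ q
    inferInstanceAs (Fintype (p.Lab Λ ⊕ q.Lab Λ))
  | case _ body =>
    haveI := fun o => labFintype Λ (body o)
    inferInstanceAs (Fintype (Option (Σ o, (body o).Lab Λ)))
  | loop _ _ body =>
    haveI := fun o => labFintype Λ (body o)
    inferInstanceAs (Fintype (Option (Σ o, (body o).Lab Λ)))
  | call _ _ => inferInstanceAs (Fintype (Bool ⊕ Λ))

/-- The label at which a program starts. -/
def entry (Λ : Type) : (p : Prog R) → p.Lab Λ
  | skip => ()
  | push _ _ => ()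
  | seq p _ => Sum.inl (p.entry Λ)
  | case _ _ => (none : Option _)
  | loop _ _ _ => (none : Option _)
  | call _ _ => Sum.inl false

variable (A : TM2ComputableAux Bool Bool)

/-- The stack alphabets of the implementing machine: those of the called machine and bits. -/
abbrev Alph (R : Type) : A.tm.K ⊕ R → Type
  | Sum.inl k => A.tm.Γ k
  | Sum.inr _ => Bool

/-- The internal states of the implementing machine. -/
abbrev St : Type := A.tm.σ × Option Bool

variable {A}

/-- Pop a symbol and continue according to the bit it stands for. -/
def popThen {T : Type} (k : A.tm.K ⊕ R) (d : Alph A R k → Bool)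
    (g : Option Bool → TM2.Stmt (Alph A R) T (St A)) : TM2.Stmt (Alph A R) T (St A) :=
  .pop k (fun v o => (v.1, o.map d)) <|
    .branch (fun v => v.2 == none) (.load (fun v => (v.1, none)) (g none)) <|
    .branch (fun v => v.2 == some true) (.load (fun v => (v.1, none)) (g (some true)))
      (.load (fun v => (v.1, none)) (g (some false)))

/-- A statement of the called machine as a statement of the implementing machine, which proceeds
to `e` instead of halting. -/
def lift {T : Type} (j : A.tm.Λ → T) (e : T) :
    TM2.Stmt A.tm.Γ A.tm.Λ A.tm.σ → TM2.Stmt (Alph A R) T (St A)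
  | .push k f q => .push (Sum.inl k) (fun v => f v.1) (lift j e q)
  | .peek k f q => .peek (Sum.inl k) (fun v o => (f v.1 o, v.2)) (lift j e q)
  | .pop k f q => .pop (Sum.inl k) (fun v o => (f v.1 o, v.2)) (lift j e q)
  | .load f q => .load (fun v => (f v.1, v.2)) (lift j e q)
  | .branch f q q' => .branch (fun v => f v.1) (lift j e q) (lift j e q')
  | .goto f => .goto (fun v => j (f v.1))
  | .halt => .goto (fun _ => e)

variable (A)

/-- The code at the labels of a program which is placed in a machine by `j` and exits to `e`. -/
def code {T : Type} : (p : Prog R) → (p.Lab A.tm.Λ → T) → T → p.Lab A.tm.Λ →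
    TM2.Stmt (Alph A R) T (St A)
  | skip, _, e, _ => .goto fun _ => e
  | push r b, _, e, _ => .push (Sum.inr r) (fun _ => b) (.goto fun _ => e)
  | seq p q, j, e, l => Sum.casesOn l
      (fun l => p.code (fun l => j (Sum.inl l)) (j (Sum.inr (q.entry _))) l)
      (fun l => q.code (fun l => j (Sum.inr l)) e l)
  | case r body, j, e, l => Option.casesOn l
      (popThen (Sum.inr r) id fun o => .goto fun _ => j (some ⟨o, (body o).entry _⟩))
      (fun l => (body l.1).code (fun l' => j (some ⟨l.1, l'⟩)) e l.2)
  | loop r cont body, j, e, l => Option.casesOn l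
      (popThen (Sum.inr r) id fun o => Option.casesOn o (.goto fun _ => e)
        (fun b => .goto fun _ => j (some ⟨b, (body b).entry _⟩)))
      (fun l => (body l.1).code (fun l' => j (some ⟨l.1, l'⟩))
        (bif cont l.1 then j (none : Option _) else e) l.2)
  | call r r', j, e, l => Sum.casesOn l
      (fun b => Bool.casesOn b
        (popThen (Sum.inr r) id fun o => Option.casesOn o
          (.goto fun _ => j (Sum.inr A.tm.main))
          (fun b => .push (Sum.inl A.tm.k₀) (fun _ => A.inputAlphabet.symm b)
            (.goto fun _ => j (Sum.inl false))))
        (popThen (Sum.inl A.tm.k₁) A.outputAlphabet fun o => Option.casesOn o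
          (.goto fun _ => e)
          (fun b => .push (Sum.inr r') (fun _ => b) (.goto fun _ => j (Sum.inl true)))))
      (fun l => lift (fun l => j (Sum.inr l)) (j (Sum.inl true)) (A.tm.m l))

variable [DecidableEq R]

/-- On input `x` the machine outputs `y` within `t` steps. -/
def Outputs (x y : List Bool) (t : ℕ) : Prop :=
  Nonempty (TM2OutputsInTime A.tm (x.map A.inputAlphabet.invFun)
    (some (y.map A.outputAlphabet.invFun)) t)

/-- `Run A p s s' t`: started on the stacks `s`, the program `p` terminates with the stacks `s'`
after at most `t` steps. -/
inductive Run : Prog R → (R → List Bool) → (R → List Bool) → ℕ → Prop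
  | skip (s) : Run skip s s 1
  | push (r b s) : Run (push r b) s (Function.update s r (b :: s r)) 1
  | seq {p q s s' s'' t t'} : Run p s s' t → Run q s' s'' t' → Run (seq p q) s s'' (t + t')
  | case {r body s s' t} :
      Run (body (s r).head?) (Function.update s r (s r).tail) s' t →
      Run (case r body) s s' (t + 1)
  | loop_nil {r cont body s} : s r = [] → Run (loop r cont body) s s 1
  | loop_exit {r cont body s s' t b l} : s r = b :: l → cont b = false →
      Run (body b) (Function.update s r l) s' t → Run (loop r cont body) s s' (t + 1)
  | loop_cont {r cont body s s' s'' t t' b l} : s r = b :: l → cont b = true →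
      Run (body b) (Function.update s r l) s' t → Run (loop r cont body) s' s'' t' →
      Run (loop r cont body) s s'' (t + 1 + t')
  | call {r r' s x y t} : r ≠ r' → s r = x.reverse → Outputs A x y t →
      Run (call r r') s (Function.update (Function.update s r []) r' (y.reverse ++ s r'))
        (x.length + 1 + t + (y.length + 1))
  | mono {p s s' t u} : Run p s s' t → t ≤ u → Run p s s' u

/-! ### Correctness of the implementation -/

/-- `b` is reached from `a` in at most `n` steps. -/
def ReachIn {σ : Type} (f : σ → Option σ) (a b : σ) (n : ℕ) : Prop :=
  ∃ m ≤ n, (flip bind f)^[m] (some a) = some b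

theorem ReachIn.refl {σ : Type} (f : σ → Option σ) (a : σ) (n : ℕ) : ReachIn f a a n :=
  ⟨0, Nat.zero_le _, rfl⟩

theorem ReachIn.trans {σ : Type} {f : σ → Option σ} {a b c : σ} {n m : ℕ}
    (h : ReachIn f a b n) (h' : ReachIn f b c m) : ReachIn f a c (n + m) := by
  obtain ⟨i, hi, hi'⟩ := h
  obtain ⟨j, hj, hj'⟩ := h'
  exact ⟨j + i, by omega, by rw [Function.iterate_add_apply, hi', hj']⟩

theorem ReachIn.mono {σ : Type} {f : σ → Option σ} {a b : σ} {n m : ℕ}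
    (h : ReachIn f a b n) (hm : n ≤ m) : ReachIn f a b m := by
  obtain ⟨i, hi, hi'⟩ := h
  exact ⟨i, hi.trans hm, hi'⟩

theorem ReachIn.single {σ : Type} {f : σ → Option σ} {a b : σ} (h : f a = some b) :
    ReachIn f a b 1 :=
  ⟨1, le_rfl, by simpa [flip] using h⟩

variable {A}

/-- The stacks of the implementing machine. -/
def join (M : ∀ k, List (A.tm.Γ k)) (s : R → List Bool) : ∀ k, List (Alph A R k)
  | Sum.inl k => M k
  | Sum.inr r => s r

theorem update_join_inr (M : ∀ k, List (A.tm.Γ k)) (s : R → List Bool) (r : R) (l : List Bool) :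
    Function.update (join M s) (Sum.inr r) l = join M (Function.update s r l) := by
  funext k
  rcases k with k | k
  · simp [join]
  · by_cases h : k = r
    · subst h; simp [join]
    · rw [Function.update_of_ne (by simpa using h)]
      simp [join, Function.update_of_ne h]

theorem update_join_inl (M : ∀ k, List (A.tm.Γ k)) (s : R → List Bool) (k : A.tm.K)
    (l : List (A.tm.Γ k)) :
    Function.update (join M s) (Sum.inl k) l = join (Function.update M k l) s := by
  funext k'
  rcases k' with k' | k'
  · by_cases h : k' = k
    · subst h; simp [join]
    · rw [Function.update_of_ne (by simpa using h)]
      simp [join, Function.update_of_ne h]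
  · simp [join]

/-- Each branch resets the one-symbol buffer, so `(v, none)` is invariant between program steps. -/
theorem stepAux_popThen {T : Type} (k : A.tm.K ⊕ R) (d : Alph A R k → Bool)
    (g : Option Bool → TM2.Stmt (Alph A R) T (St A)) (v : A.tm.σ) (S : ∀ k, List (Alph A R k)) :
    TM2.stepAux (popThen k d g) (v, none) S =
      TM2.stepAux (g ((S k).head?.map d)) (v, none) (Function.update S k (S k).tail) := by
  rcases h : (S k).head?.map d with _ | b
  · simp [popThen, h]
  · cases b <;> simp [popThen, h]

/-- A lifted statement touches only the stacks of the called machine, so the stacks `s` ride along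
unchanged; a halt turns into a jump to `e`. -/
theorem stepAux_lift {T : Type} (j : A.tm.Λ → T) (e : T) (s : R → List Bool)
    (q : TM2.Stmt A.tm.Γ A.tm.Λ A.tm.σ) (v : A.tm.σ) (M : ∀ k, List (A.tm.Γ k)) :
    TM2.stepAux (lift j e q) (v, none) (join M s) =
      (let c := TM2.stepAux q v M
       ⟨some ((c.l.map j).getD e), (c.var, none), join c.stk s⟩ :
        TM2.Cfg (Alph A R) T (St A)) := by
  induction q generalizing v M with
  | push k f q ih => simp only [lift, TM2.stepAux, update_join_inl, ← ih]; rfl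
  | peek k f q ih => simp only [lift, TM2.stepAux, ← ih]; rfl
  | pop k f q ih => simp only [lift, TM2.stepAux, update_join_inl, ← ih]; rfl
  | load f q ih => simp only [lift, TM2.stepAux, ← ih]
  | branch f q q' ih ih' =>
    simp only [lift, TM2.stepAux]
    cases f v
    · simpa using ih' v M
    · simpa using ih v M
  | goto f => simp [lift]
  | halt => simp [lift]

end Prog
end FourierStep

/-! ### Simulation of a program by a Turing machine -/

namespace FourierStep

open Turing
namespace Prog
variable {R : Type} [DecidableEq R] {A : TM2ComputableAux Bool Bool}

/-- A configuration in which the called machine is in its initial state. -/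
def cfg {T : Type} (l : T) (M : ∀ k, List (A.tm.Γ k)) (s : R → List Bool) :
    TM2.Cfg (Alph A R) T (St A) :=
  ⟨some l, (A.tm.initialState, none), join M s⟩

theorem initList_stk (tm : FinTM2) (x : List (tm.Γ tm.k₀)) :
    (initList tm x).stk = Function.update (fun _ => []) tm.k₀ x := by
  funext k
  by_cases h : k = tm.k₀
  · subst h; simp [initList]
  · simp [initList, h]

theorem haltList_stk (tm : FinTM2) (x : List (tm.Γ tm.k₁)) :
    (haltList tm x).stk = Function.update (fun _ => []) tm.k₁ x := by
  funext k
  by_cases h : k = tm.k₁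
  · subst h; simp [haltList]
  · simp [haltList, h]

theorem step_eq {T : Type} {m : T → TM2.Stmt (Alph A R) T (St A)} {l : T}
    {q : TM2.Stmt (Alph A R) T (St A)} (h : m l = q) (M : ∀ k, List (A.tm.Γ k))
    (s : R → List Bool) :
    TM2.step m (cfg l M s) = some (TM2.stepAux q (A.tm.initialState, none) (join M s)) := by
  rw [cfg, TM2.step, h]

section call

variable {T : Type} {m : T → TM2.Stmt (Alph A R) T (St A)} {r r' : R}
  {j : (call r r').Lab A.tm.Λ → T} {e : T}

/-- Transfer from stack to stack reverses the word, which is why a call works on reversed contents.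
The accumulator `c` is there for the induction. -/
theorem reach_load (hm : ∀ l, m (j l) = code A (call r r') j e l) (l : List Bool)
    (s : R → List Bool) (c : List (A.tm.Γ A.tm.k₀)) (hs : s r = l) :
    ReachIn (TM2.step m) (cfg (j (Sum.inl false)) (Function.update (fun _ => []) A.tm.k₀ c) s)
      (cfg (j (Sum.inr A.tm.main))
        (Function.update (fun _ => []) A.tm.k₀ (l.reverse.map A.inputAlphabet.symm ++ c))
        (Function.update s r [])) (l.length + 1) := by
  induction l generalizing s c with
  | nil =>
    refine ReachIn.single ?_
    refine (step_eq (hm (Sum.inl false)) _ _).trans ?_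
    simp only [code, stepAux_popThen, update_join_inr, cfg]
    simp [join, hs]
  | cons b l ih =>
    have h := ih (Function.update s r l) (A.inputAlphabet.symm b :: c) (by simp)
    rw [Function.update_idem] at h
    rw [List.length_cons, add_comm]
    refine ReachIn.trans (ReachIn.single ?_) (by simpa using h)
    refine (step_eq (hm (Sum.inl false)) _ _).trans ?_
    simp only [code, stepAux_popThen, update_join_inr, cfg]
    simp [join, hs, update_join_inl]

theorem reach_unload (hm : ∀ l, m (j l) = code A (call r r') j e l) (l : List Bool)
    (s : R → List Bool) :
    ReachIn (TM2.step m)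
      (cfg (j (Sum.inl true)) (Function.update (fun _ => []) A.tm.k₁
        (l.map A.outputAlphabet.symm)) s)
      (cfg e (fun _ => []) (Function.update s r' (l.reverse ++ s r'))) (l.length + 1) := by
  induction l generalizing s with
  | nil =>
    refine ReachIn.single ?_
    refine (step_eq (hm (Sum.inl true)) _ _).trans ?_
    simp only [code, stepAux_popThen, update_join_inl, cfg]
    simp [join]
  | cons b l ih =>
    have h := ih (Function.update s r' (b :: s r'))
    rw [Function.update_idem] at h
    rw [List.length_cons, add_comm]
    refine ReachIn.trans (ReachIn.single ?_) (by simpa using h)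
    refine (step_eq (hm (Sum.inl true)) _ _).trans ?_
    simp only [code, stepAux_popThen, update_join_inl, cfg]
    simp [join, update_join_inr]

theorem reach_lift (hm : ∀ l, m (j l) = code A (call r r') j e l) (s : R → List Bool)
    (n : ℕ) (c d : A.tm.Cfg) (h : (flip bind A.tm.step)^[n] (some c) = some d) :
    ReachIn (TM2.step m)
      ⟨some ((c.l.map fun l => j (Sum.inr l)).getD (j (Sum.inl true))), (c.var, none), join c.stk s⟩
      ⟨some ((d.l.map fun l => j (Sum.inr l)).getD (j (Sum.inl true))), (d.var, none), join d.stk s⟩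
      n := by
  induction n generalizing c with
  | zero =>
    simp only [Function.iterate_zero, id_eq, Option.some.injEq] at h
    subst h
    exact ReachIn.refl _ _ _
  | succ n ih =>
    rw [Function.iterate_succ_apply] at h
    obtain ⟨_ | l, v, S⟩ := c
    -- A halted configuration has no successor, so a run with a step left that ends in `some d`
    -- cannot start from one.
    · have : ∀ n, (flip bind A.tm.step)^[n] none = none := fun n => by
        induction n with
        | zero => rfl
        | succ n ih => rw [Function.iterate_succ_apply]; exact ih
      rw [show flip bind A.tm.step (some ⟨none, v, S⟩) = none from rfl, this] at h
      cases h
    · have h' := ih (TM2.stepAux (A.tm.m l) v S) h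
      rw [add_comm]
      refine ReachIn.trans (ReachIn.single ?_) h'
      have hl : m (j (Sum.inr l)) = lift (fun l => j (Sum.inr l)) (j (Sum.inl true)) (A.tm.m l) :=
        hm (Sum.inr l)
      rw [Option.map_some, Option.getD_some, TM2.step, hl, stepAux_lift]

end call

/-- Induction on the timed semantics. The invariant is that between instructions the called machine
has empty stacks and its initial state. A call restores it: `haltList` prescribes the initial state
and allows contents only on the output stack, which is then unloaded. Hence the machine can be
called repeatedly. -/
theorem Run.reach {p : Prog R} {s s' : R → List Bool} {t : ℕ} (h : Run A p s s' t) {T : Type}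
    {m : T → TM2.Stmt (Alph A R) T (St A)} {j : p.Lab A.tm.Λ → T} {e : T}
    (hm : ∀ l, m (j l) = code A p j e l) :
    ReachIn (TM2.step m) (cfg (j (p.entry _)) (fun _ => []) s) (cfg e (fun _ => []) s') t := by
  induction h generalizing e with
  | skip s => exact ReachIn.single (by simp [cfg, hm, code])
  | push r b s => exact ReachIn.single (by simp [cfg, hm, code, update_join_inr, join])
  | @seq p q s s' s'' t t' h h' ih ih' =>
    refine ReachIn.trans (ih (j := fun l => j (Sum.inl l)) (e := j (Sum.inr (q.entry _))) ?_)
      (ih' (j := fun l => j (Sum.inr l)) ?_)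
    · intro l; exact hm (Sum.inl l)
    · intro l; exact hm (Sum.inr l)
  | @case r body s s' t h ih =>
    rw [add_comm]
    refine ReachIn.trans (ReachIn.single ?_)
      (ih (j := fun l => j (some ⟨_, l⟩)) (fun l => hm (some ⟨_, l⟩)))
    refine (step_eq (hm (none : Option _)) _ _).trans ?_
    simp only [code, stepAux_popThen, update_join_inr, cfg]
    simp only [join, TM2.stepAux, Option.some.injEq, TM2.Cfg.mk.injEq, and_true]
    generalize (s r).head? = o
    cases o <;> rfl
  | @loop_nil r cont body s hs =>
    refine ReachIn.single ?_
    refine (step_eq (hm (none : Option _)) _ _).trans ?_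
    simp only [code, stepAux_popThen, update_join_inr, cfg]
    simp [join, hs]
    rw [← hs, Function.update_eq_self]
  | @loop_exit r cont body s s' t b l hs hb h ih =>
    rw [add_comm]
    refine ReachIn.trans (ReachIn.single ?_)
      (ih (j := fun l => j (some ⟨_, l⟩)) (fun l => (hm (some ⟨_, l⟩)).trans ?_))
    · refine (step_eq (hm (none : Option _)) _ _).trans ?_
      simp only [code, stepAux_popThen, update_join_inr, cfg]
      simp [join, hs]
    · simp [code, hb]
  | @loop_cont r cont body s s' s'' t t' b l hs hb h h' ih ih' =>
    rw [add_comm t 1]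
    refine ReachIn.trans (ReachIn.trans (ReachIn.single ?_)
      (ih (j := fun l => j (some ⟨_, l⟩)) (e := j (none : Option _))
        (fun l => (hm (some ⟨_, l⟩)).trans ?_))) (ih' hm)
    · refine (step_eq (hm (none : Option _)) _ _).trans ?_
      simp only [code, stepAux_popThen, update_join_inr, cfg]
      simp [join, hs]
    · simp [code, hb]
  | @call r r' s x y t hr hs ho =>
    obtain ⟨⟨⟨n, hn⟩, hnt⟩⟩ := ho
    -- Three phases: load the input, simulate the machine, unload its output.
    refine ReachIn.trans (ReachIn.trans ?_
      ((reach_lift hm (Function.update s r []) n _ _ hn).mono hnt)) ?_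
    · have := reach_load hm x.reverse s [] hs
      simp only [List.length_reverse, List.reverse_reverse, List.append_nil] at this
      rw [Function.update_eq_self_iff.2 rfl] at this
      rw [initList_stk]
      exact this
    · have := reach_unload hm y (Function.update s r [])
      rw [Function.update_of_ne hr.symm] at this
      rw [haltList_stk]
      exact this
  | mono h ht ih => exact (ih hm).mono ht

/-- The machine which executes a program, with input stack `r` and output stack `r'`. -/
def machine [Fintype R] (A : TM2ComputableAux Bool Bool) (p : Prog R) (r r' : R) : FinTM2 :=
  letI := A.tm.kFin
  letI := A.tm.ΛFin
  letI := A.tm.σFin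
  letI := labFintype A.tm.Λ p
  { K := A.tm.K ⊕ R
    k₀ := Sum.inr r
    k₁ := Sum.inr r'
    Γ := Alph A R
    Λ := Option (p.Lab A.tm.Λ)
    main := some (p.entry _)
    σ := St A
    initialState := (A.tm.initialState, none)
    Γk₀Fin := inferInstanceAs (Fintype Bool)
    m := fun l => Option.casesOn l .halt (fun l => code A p some none l) }

theorem update_nil_inr (r : R) (l : List Bool) :
    (Function.update (fun _ => []) (Sum.inr r) l : ∀ k, List (Alph A R k)) =
      join (fun _ => []) (Function.update (fun _ => []) r l) := by
  rw [← update_join_inr]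
  congr 1
  funext k
  cases k <;> rfl

/-- A program which, for every input, transforms the input stack to the output stack in polynomial
time witnesses polynomial-time computability. -/
theorem polyTime_of_run [Fintype R] {α β : Type} {ea : α → List Bool} {eb : β → List Bool}
    {F : α → β} (A : TM2ComputableAux Bool Bool) (p : Prog R) (r r' : R) (P : Polynomial ℕ)
    (h : ∀ a, Run A p (Function.update (fun _ => []) r (ea a))
      (Function.update (fun _ => []) r' (eb (F a))) (P.eval (ea a).length)) :
    PolyTime ea eb F := by
  -- The extra step is the halt at the exit label `none`.
  refine ⟨⟨⟨machine A p r r', Equiv.refl Bool, Equiv.refl Bool⟩, P + 1, fun a => ?_⟩⟩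
  refine Classical.choice ?_
  have h1 := (h a).reach (m := (machine A p r r').m) (j := some) (e := none) (fun _ => rfl)
  have h2 : ReachIn (machine A p r r').step
      (cfg none (fun _ => []) (Function.update (fun _ => []) r' (eb (F a))))
      ⟨none, (A.tm.initialState, none), join (fun _ => [])
        (Function.update (fun _ => []) r' (eb (F a)))⟩ 1 :=
    ReachIn.single rfl
  obtain ⟨n, hn, hn'⟩ := ReachIn.trans h1 h2
  have e1 : initList (machine A p r r') (ea a) = cfg (some (p.entry _)) (fun _ => [])
      (Function.update (fun _ => []) r (ea a)) := by
    refine congrArg (fun S => (⟨some (some (p.entry _)), (A.tm.initialState, none), S⟩ :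
      TM2.Cfg (Alph A R) (Option (p.Lab A.tm.Λ)) (St A))) ?_
    exact (initList_stk (machine A p r r') (ea a)).trans (update_nil_inr r (ea a))
  have e2 : haltList (machine A p r r') (eb (F a)) = ⟨none, (A.tm.initialState, none),
      join (fun _ => []) (Function.update (fun _ => []) r' (eb (F a)))⟩ := by
    refine congrArg (fun S => (⟨none, (A.tm.initialState, none), S⟩ :
      TM2.Cfg (Alph A R) (Option (p.Lab A.tm.Λ)) (St A))) ?_
    exact (haltList_stk (machine A p r r') (eb (F a))).trans (update_nil_inr r' (eb (F a)))
  refine ⟨⟨⟨n, ?_⟩, ?_⟩⟩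
  · simp only [Equiv.refl]
    erw [List.map_id, List.map_id]
    erw [e1]
    exact hn'.trans (congrArg some e2.symm)
  · simpa using hn

end Prog
end FourierStep

namespace FourierStep

open Turing
namespace Prog

/-! ### Basic programs -/

section basic

variable {R : Type} [DecidableEq R] {A : TM2ComputableAux Bool Bool}

/-- Move the contents of `r` to `q`, applying `g` to every bit. -/
def moveMap (g : Bool → Bool) (r q : R) : Prog R := loop r (fun _ => true) fun b => push q (g b)

/-- Move the contents of `r` to `q`. -/
def move (r q : R) : Prog R := moveMap id r q

/-- Move the contents of `r` to `q` and add its length in unary to `q'`. -/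
def moveCount (r q q' : R) : Prog R :=
  loop r (fun _ => true) fun b => seq (push q b) (push q' true)

/-- Empty the stack `r`. -/
def clear (r : R) : Prog R := loop r (fun _ => true) fun _ => skip

/-- Pop a maximal block of bits `c` and the bit following it; the length of the block is added in
unary to `q`. -/
def scan (r q : R) (c : Bool) : Prog R :=
  loop r (fun b => b == c) fun b => bif b == c then push q true else skip

/-- Pop up to and including the first `true`, which is pushed onto `q`. -/
def seek (r q : R) : Prog R := loop r (fun b => !b) fun b => bif b then push q true else skip

/-- Move the bits `true` of `r` to `q` and discard the others. -/
def collect (r q : R) : Prog R :=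
  loop r (fun _ => true) fun b => bif b then push q true else skip

/-- For each bit of `r` remove one from `q`; the excess is added in unary to `f`. -/
def sub (r q f : R) : Prog R :=
  loop r (fun _ => true) fun _ => case q fun o => bif o.isNone then push f true else skip

/-- Move the top bits of `q` to `w`, one for each bit of `r`. -/
def takeMove (r q w : R) : Prog R :=
  loop r (fun _ => true) fun _ => case q fun o => o.elim skip fun b => push w b

/-- Push `n` bits `true`. -/
def pushOnes (r : R) : ℕ → Prog R
  | 0 => skip
  | n + 1 => seq (pushOnes r n) (push r true)

theorem replicate_append_cons {α : Type} (n : ℕ) (a : α) (l : List α) :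
    List.replicate n a ++ a :: l = List.replicate (n + 1) a ++ l := by
  rw [List.replicate_succ', List.append_assoc]; rfl

theorem Run.of_eq {p : Prog R} {s s₁ s₂ : R → List Bool} {t t' : ℕ} (h : Run A p s s₁ t)
    (hs : s₁ = s₂) (ht : t ≤ t') : Run A p s s₂ t' :=
  (hs ▸ h).mono ht

theorem run_moveMap (g : Bool → Bool) {r q : R} (h : r ≠ q) (s : R → List Bool) :
    Run A (moveMap g r q) s
      (Function.update (Function.update s r []) q (((s r).map g).reverse ++ s q))
      (2 * (s r).length + 1) := by
  generalize hl : s r = l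
  induction l generalizing s with
  | nil =>
    refine (Run.loop_nil hl).of_eq ?_ (by simp)
    funext k
    simp only [Function.update_apply]
    split_ifs <;> simp_all
  | cons b l ih =>
    refine (Run.loop_cont hl rfl (Run.push q (g b) _) (ih _ ?_)).of_eq ?_ ?_
    · simp [h]
    · funext k
      simp only [Function.update_apply]
      split_ifs <;> simp_all
    · simp; omega

theorem run_move {r q : R} (h : r ≠ q) (s : R → List Bool) :
    Run A (move r q) s
      (Function.update (Function.update s r []) q ((s r).reverse ++ s q))
      (2 * (s r).length + 1) := by
  have := run_moveMap (A := A) id h s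
  rwa [List.map_id] at this

theorem run_moveCount {r q q' : R} (h : r ≠ q) (h' : r ≠ q') (h'' : q ≠ q') (s : R → List Bool) :
    Run A (moveCount r q q') s
      (Function.update (Function.update (Function.update s r []) q ((s r).reverse ++ s q))
        q' (List.replicate (s r).length true ++ s q'))
      (3 * (s r).length + 1) := by
  generalize hl : s r = l
  induction l generalizing s with
  | nil =>
    refine (Run.loop_nil hl).of_eq ?_ (by simp)
    funext k
    simp only [Function.update_apply]
    split_ifs <;> simp_all
  | cons b l ih =>
    refine (Run.loop_cont hl rfl (Run.seq (Run.push _ _ _) (Run.push _ _ _)) (ih _ ?_)).of_eq ?_ ?_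
    · simp [h, h']
    · funext k
      simp only [Function.update_apply]
      split_ifs <;> simp_all [replicate_append_cons]
    · simp; omega

theorem run_clear (r : R) (s : R → List Bool) :
    Run A (clear r) s (Function.update s r []) (2 * (s r).length + 1) := by
  generalize hl : s r = l
  induction l generalizing s with
  | nil =>
    refine (Run.loop_nil hl).of_eq ?_ (by simp)
    rw [← hl, Function.update_eq_self]
  | cons b l ih =>
    refine (Run.loop_cont hl rfl (Run.skip _) (ih _ ?_)).of_eq ?_ ?_
    · simp
    · simp
    · simp; omega

theorem run_scan {r q : R} (c : Bool) (h : r ≠ q) (s : R → List Bool) :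
    Run A (scan r q c) s
      (Function.update (Function.update s r ((s r).drop (((s r).takeWhile (· == c)).length + 1))) q
        (List.replicate ((s r).takeWhile (· == c)).length true ++ s q))
      (2 * (s r).length + 1) := by
  generalize hl : s r = l
  induction l generalizing s with
  | nil =>
    refine (Run.loop_nil hl).of_eq ?_ (by simp)
    funext k
    simp only [Function.update_apply]
    split_ifs <;> simp_all
  | cons b l ih =>
    by_cases hb : b = c
    · subst hb
      refine (Run.loop_cont hl (by simp) (t := 1) (s' := Function.update (Function.update s r l) q
        (true :: s q)) ?_ (ih _ ?_)).of_eq ?_ ?_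
      · simpa [h.symm] using Run.push (A := A) q true (Function.update s r l)
      · simp [h]
      · funext k
        simp only [Function.update_apply]
        split_ifs <;> simp_all [replicate_append_cons]
      · simp; omega
    · refine (Run.loop_exit hl (by simpa using hb) (t := 1)
        (s' := Function.update s r l) ?_).of_eq ?_ ?_
      · rw [beq_false_of_ne hb]
        exact Run.skip _
      · funext k
        simp only [Function.update_apply]
        split_ifs <;> simp_all
      · simp; omega

theorem run_seek {r q : R} (h : r ≠ q) (s : R → List Bool) (hq : s q = []) :
    Run A (seek r q) s
      (Function.update (Function.update s r ((s r).dropWhile (!·)).tail) q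
        ((s r).dropWhile (!·)).head?.toList)
      (2 * (s r).length + 1) := by
  generalize hl : s r = l
  induction l generalizing s with
  | nil =>
    refine (Run.loop_nil hl).of_eq ?_ (by simp)
    funext k
    simp only [Function.update_apply]
    split_ifs <;> simp_all
  | cons b l ih =>
    cases b with
    | false =>
      refine (Run.loop_cont hl rfl (Run.skip _) (ih _ ?_ ?_)).of_eq ?_ ?_
      · simp [h.symm, hq]
      · simp
      · simp
      · simp; omega
    | true =>
      refine (Run.loop_exit (body := fun b => bif b then push q true else skip) hl rfl
        (Run.push _ _ _)).of_eq ?_ ?_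
      · simp [h.symm, hq]
      · simp; omega

theorem run_collect {r q : R} (h : r ≠ q) (s : R → List Bool) :
    Run A (collect r q) s
      (Function.update (Function.update s r []) q
        (List.replicate ((s r).count true) true ++ s q))
      (2 * (s r).length + 1) := by
  generalize hl : s r = l
  induction l generalizing s with
  | nil =>
    refine (Run.loop_nil hl).of_eq ?_ (by simp)
    funext k
    simp only [Function.update_apply]
    split_ifs <;> simp_all
  | cons b l ih =>
    cases b with
    | false =>
      refine (Run.loop_cont hl rfl (Run.skip _) (ih _ ?_)).of_eq ?_ ?_
      · simp
      · funext k
        simp only [Function.update_apply]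
        split_ifs <;> simp_all
      · simp; omega
    | true =>
      refine (Run.loop_cont (body := fun b => bif b then push q true else skip) hl rfl
        (Run.push _ _ _) (ih _ ?_)).of_eq ?_ ?_
      · simp [h]
      · funext k
        simp only [Function.update_apply]
        split_ifs <;> simp_all [replicate_append_cons]
      · simp; omega

theorem run_sub {r q f : R} (h : r ≠ q) (h' : r ≠ f) (h'' : q ≠ f) (s : R → List Bool) :
    Run A (sub r q f) s
      (Function.update (Function.update (Function.update s r []) q ((s q).drop (s r).length)) f
        (List.replicate ((s r).length - (s q).length) true ++ s f))
      (3 * (s r).length + 1) := by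
  generalize hl : s r = l
  induction l generalizing s with
  | nil =>
    refine (Run.loop_nil hl).of_eq ?_ (by simp)
    funext k
    simp only [Function.update_apply]
    split_ifs <;> simp_all
  | cons b l ih =>
    rcases hq : s q with _ | ⟨c, l'⟩
    · refine (Run.loop_cont hl rfl (Run.case (t := 1)
        (s' := Function.update (Function.update s r l) f (true :: s f)) ?_) (ih _ ?_)).of_eq ?_ ?_
      · have := Run.push (A := A) f true (Function.update s r l)
        rw [Function.update_of_ne h.symm, hq]
        convert! this using 1
        · rw [Function.update_eq_self_iff]; simp [h.symm, hq]
        · simp [h'.symm]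
      · simp [h']
      · funext k
        simp only [Function.update_apply]
        split_ifs <;> simp_all [replicate_append_cons]
      · simp; omega
    · refine (Run.loop_cont hl rfl (Run.case (t := 1)
        (s' := Function.update (Function.update s r l) q l') ?_) (ih _ ?_)).of_eq ?_ ?_
      · rw [Function.update_of_ne h.symm, hq]
        exact Run.skip _
      · simp [h]
      · funext k
        simp only [Function.update_apply]
        split_ifs <;> simp_all
      · simp; omega

theorem run_takeMove {r q w : R} (h : r ≠ q) (h' : r ≠ w) (h'' : q ≠ w) (s : R → List Bool) :
    Run A (takeMove r q w) s
      (Function.update (Function.update (Function.update s r []) q ((s q).drop (s r).length)) w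
        (((s q).take (s r).length).reverse ++ s w))
      (3 * (s r).length + 1) := by
  generalize hl : s r = l
  induction l generalizing s with
  | nil =>
    refine (Run.loop_nil hl).of_eq ?_ (by simp)
    funext k
    simp only [Function.update_apply]
    split_ifs <;> simp_all
  | cons b l ih =>
    rcases hq : s q with _ | ⟨c, l'⟩
    · refine (Run.loop_cont hl rfl (Run.case (t := 1)
        (s' := Function.update s r l) ?_) (ih _ ?_)).of_eq ?_ ?_
      · rw [Function.update_of_ne h.symm, hq]
        have := Run.skip (A := A) (Function.update s r l)
        convert! this using 1
        rw [Function.update_eq_self_iff]; simp [h.symm, hq]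
      · simp
      · funext k
        simp only [Function.update_apply]
        split_ifs <;> simp_all
      · simp; omega
    · refine (Run.loop_cont hl rfl (Run.case (t := 1)
        (s' := Function.update (Function.update (Function.update s r l) q l') w (c :: s w)) ?_)
          (ih _ ?_)).of_eq ?_ ?_
      · rw [Function.update_of_ne h.symm, hq]
        have := Run.push (A := A) w c (Function.update (Function.update s r l) q l')
        rwa [Function.update_of_ne h''.symm, Function.update_of_ne h'.symm] at this
      · simp [h, h']
      · funext k
        simp only [Function.update_apply]
        split_ifs <;> simp_all
      · simp; omega

theorem run_pushOnes (r : R) (n : ℕ) (s : R → List Bool) :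
    Run A (pushOnes r n) s (Function.update s r (List.replicate n true ++ s r)) (n + 1) := by
  induction n with
  | zero => exact (Run.skip _).of_eq (by simp) le_rfl
  | succ n ih =>
    refine (Run.seq ih (Run.push _ _ _)).of_eq ?_ le_rfl
    simp [List.replicate_succ]

end basic
end Prog
end FourierStep

namespace FourierStep

open Turing

/-! ### Programs on a fixed collection of stacks -/

/-- Names of stacks. -/
inductive Reg : Type
  | inp | out | prec | zer | num | wit | rev | arg | res | bad | hit | acc | tmp | aux | len

instance : DecidableEq Reg := Classical.decEq _

instance : Fintype Reg where
  elems := {.inp, .out, .prec, .zer, .num, .wit, .rev, .arg, .res, .bad, .hit, .acc, .tmp, .aux,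
    .len}
  complete k := by cases k <;> simp

/-- The contents of the stacks. -/
structure Stacks where
  inp : List Bool := []
  out : List Bool := []
  prec : List Bool := []
  zer : List Bool := []
  num : List Bool := []
  wit : List Bool := []
  rev : List Bool := []
  arg : List Bool := []
  res : List Bool := []
  bad : List Bool := []
  hit : List Bool := []
  acc : List Bool := []
  tmp : List Bool := []
  aux : List Bool := []
  len : List Bool := []

namespace Stacks

/-- The contents of a stack given by its name. -/
def get (S : Stacks) : Reg → List Bool
  | .inp => S.inp
  | .out => S.out
  | .prec => S.prec
  | .zer => S.zer
  | .num => S.num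
  | .wit => S.wit
  | .rev => S.rev
  | .arg => S.arg
  | .res => S.res
  | .bad => S.bad
  | .hit => S.hit
  | .acc => S.acc
  | .tmp => S.tmp
  | .aux => S.aux
  | .len => S.len

variable (S : Stacks)

@[simp] theorem update_inp (l : List Bool) :
    Function.update S.get .inp l = { S with inp := l }.get := by
  funext k; cases k <;> simp [get]

@[simp] theorem update_out (l : List Bool) :
    Function.update S.get .out l = { S with out := l }.get := by
  funext k; cases k <;> simp [get]

@[simp] theorem update_prec (l : List Bool) :
    Function.update S.get .prec l = { S with prec := l }.get := by
  funext k; cases k <;> simp [get]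

@[simp] theorem update_zer (l : List Bool) :
    Function.update S.get .zer l = { S with zer := l }.get := by
  funext k; cases k <;> simp [get]

@[simp] theorem update_num (l : List Bool) :
    Function.update S.get .num l = { S with num := l }.get := by
  funext k; cases k <;> simp [get]

@[simp] theorem update_wit (l : List Bool) :
    Function.update S.get .wit l = { S with wit := l }.get := by
  funext k; cases k <;> simp [get]

@[simp] theorem update_rev (l : List Bool) :
    Function.update S.get .rev l = { S with rev := l }.get := by
  funext k; cases k <;> simp [get]

@[simp] theorem update_arg (l : List Bool) :
    Function.update S.get .arg l = { S with arg := l }.get := by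
  funext k; cases k <;> simp [get]

@[simp] theorem update_res (l : List Bool) :
    Function.update S.get .res l = { S with res := l }.get := by
  funext k; cases k <;> simp [get]

@[simp] theorem update_bad (l : List Bool) :
    Function.update S.get .bad l = { S with bad := l }.get := by
  funext k; cases k <;> simp [get]

@[simp] theorem update_hit (l : List Bool) :
    Function.update S.get .hit l = { S with hit := l }.get := by
  funext k; cases k <;> simp [get]

@[simp] theorem update_acc (l : List Bool) :
    Function.update S.get .acc l = { S with acc := l }.get := by
  funext k; cases k <;> simp [get]

@[simp] theorem update_tmp (l : List Bool) :
    Function.update S.get .tmp l = { S with tmp := l }.get := by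
  funext k; cases k <;> simp [get]

@[simp] theorem update_aux (l : List Bool) :
    Function.update S.get .aux l = { S with aux := l }.get := by
  funext k; cases k <;> simp [get]

@[simp] theorem update_len (l : List Bool) :
    Function.update S.get .len l = { S with len := l }.get := by
  funext k; cases k <;> simp [get]

end Stacks

theorem polynomial_eval_mono (P : Polynomial ℕ) {m n : ℕ} (h : m ≤ n) : P.eval m ≤ P.eval n := by
  simp only [Polynomial.eval_eq_sum_range]
  gcongr

/-! ### Polynomial time bounds and evaluation of polynomials in unary -/

namespace Prog

variable {A : TM2ComputableAux Bool Bool}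

/-- The program takes the stacks `S a` to `S' a`, for all `a`, in time polynomial in `sz a`. -/
def PolyRun (A : TM2ComputableAux Bool Bool) {ι : Type} (sz : ι → ℕ) (p : Prog Reg)
    (S S' : ι → Stacks) : Prop :=
  ∃ P : Polynomial ℕ, ∀ a, Run A p (S a).get (S' a).get (P.eval (sz a))

theorem PolyRun.seq {ι : Type} {sz : ι → ℕ} {p q : Prog Reg} {S S' S'' : ι → Stacks}
    (h : PolyRun A sz p S S') (h' : PolyRun A sz q S' S'') : PolyRun A sz (seq p q) S S'' := by
  obtain ⟨P, hP⟩ := h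
  obtain ⟨Q, hQ⟩ := h'
  exact ⟨P + Q, fun a => by simpa using Run.seq (hP a) (hQ a)⟩

theorem PolyRun.of_run {ι : Type} {sz : ι → ℕ} {p : Prog Reg} {S S' : ι → Stacks}
    (P : Polynomial ℕ) {s' : ι → Reg → List Bool} {t : ι → ℕ}
    (h : ∀ a, Run A p (S a).get (s' a) (t a)) (hs : ∀ a, s' a = (S' a).get)
    (ht : ∀ a, t a ≤ P.eval (sz a)) : PolyRun A sz p S S' :=
  ⟨P, fun a => (h a).of_eq (hs a) (ht a)⟩

/-- Horner evaluation of a polynomial given by its coefficients. -/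
def horner : List ℕ → ℕ → ℕ
  | [], _ => 0
  | a :: l, n => a + n * horner l n

theorem exists_horner (P : Polynomial ℕ) : ∃ l, ∀ n, horner l n = P.eval n := by
  induction P using Polynomial.recOnHorner with
  | M0 => exact ⟨[], fun n => by simp [horner]⟩
  | MC P a _ _ ih =>
    obtain ⟨l, hl⟩ := ih
    cases l with
    | nil => exact ⟨[a], fun n => by rw [Polynomial.eval_add, ← hl]; simp [horner]⟩
    | cons b l =>
      exact ⟨(b + a) :: l, fun n => by rw [Polynomial.eval_add, ← hl]; simp [horner]; ring⟩
  | MX P _ ih =>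
    obtain ⟨l, hl⟩ := ih
    exact ⟨0 :: l, fun n => by simp [horner, hl, mul_comm]⟩

theorem exists_eval_eq_horner (l : List ℕ) : ∃ Q : Polynomial ℕ, ∀ n, horner l n = Q.eval n := by
  induction l with
  | nil => exact ⟨0, by simp [horner]⟩
  | cons a l ih =>
    obtain ⟨Q, hQ⟩ := ih
    exact ⟨Polynomial.C a + Polynomial.X * Q, by simp [horner, hQ]⟩

/-- Write the value of a polynomial at the length of `num` in unary to `acc`. -/
def evalHorner : List ℕ → Prog Reg
  | [] => skip
  | a :: l => seq (evalHorner l) <|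
      seq (loop .acc (fun _ => true) fun _ => seq (moveCount .num .aux .tmp) (move .aux .num)) <|
      seq (move .tmp .acc) (pushOnes .acc a)

/-- Unary multiplication: every bit of `acc` adds a copy of `num` to `tmp`, with `aux` holding `num`
while it is copied. -/
theorem run_mulLoop (S : Stacks) (h : S.aux = []) :
    Run A (loop .acc (fun _ => true) fun _ => seq (moveCount .num .aux .tmp) (move .aux .num))
      S.get { S with acc := [],
                     tmp := List.replicate (S.num.length * S.acc.length) true ++ S.tmp }.get
      ((5 * S.num.length + 3) * S.acc.length + 1) := by
  generalize hl : S.acc = l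
  induction l generalizing S with
  | nil =>
    refine (Run.loop_nil (by simpa [Stacks.get] using hl)).of_eq ?_ (by simp)
    cases S
    simp_all
  | cons b l ih =>
    refine (Run.loop_cont (show S.get .acc = _ from hl) rfl
      (s' := { S with acc := l, tmp := List.replicate S.num.length true ++ S.tmp }.get)
      (t := 5 * S.num.length + 2) ?_ (ih _ ?_ ?_)).of_eq ?_ ?_
    · refine (Run.seq (run_moveCount (by simp) (by simp) (by simp) _)
        (run_move (by simp) _)).of_eq ?_ ?_
      · simp [Stacks.get, h]
      · simp [Stacks.get, h]; omega
    · simp [h]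
    · rfl
    · simp only [List.length_cons, mul_add, mul_one, List.replicate_add, List.append_assoc]
    · simp; ring_nf; omega

theorem run_evalHorner (l : List ℕ) : ∃ P : Polynomial ℕ, ∀ S : Stacks, S.acc = [] → S.tmp = [] →
    S.aux = [] → Run A (evalHorner l) S.get
      { S with acc := List.replicate (horner l S.num.length) true }.get
      (P.eval S.num.length) := by
  induction l with
  | nil =>
    refine ⟨1, fun S h _ _ => (Run.skip _).of_eq ?_ (by simp)⟩
    simp [horner, ← h]
  | cons a l ih =>
    obtain ⟨P, hP⟩ := ih
    obtain ⟨Q, hQ⟩ := exists_eval_eq_horner l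
    refine ⟨P + (((5 * Polynomial.X + 3) * Q + 1) + ((2 * (Polynomial.X * Q) + 1) +
      Polynomial.C (a + 1))), fun S h htmp haux => ?_⟩
    refine (Run.seq (hP S h htmp haux) (Run.seq (run_mulLoop _ haux)
      (Run.seq (run_move (by simp) _) (run_pushOnes _ a _)))).of_eq ?_ ?_
    · simp [Stacks.get, htmp, horner]
    · simp [Stacks.get, hQ, htmp]

/-- Write the value of `q` at the length of `num` in unary to `acc`. -/
def evalPoly (q : Polynomial ℕ) : Prog Reg := evalHorner (exists_horner q).choose

theorem polyRun_evalPoly (q : Polynomial ℕ) {ι : Type} {sz : ι → ℕ} {S : ι → Stacks}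
    (h₁ : ∀ a, (S a).acc = []) (h₂ : ∀ a, (S a).tmp = []) (h₃ : ∀ a, (S a).aux = [])
    (hn : ∀ a, (S a).num.length ≤ sz a) :
    PolyRun A sz (evalPoly q) S
      (fun a => { S a with acc := List.replicate (q.eval (S a).num.length) true }) := by
  obtain ⟨P, hP⟩ := run_evalHorner (A := A) (exists_horner q).choose
  refine PolyRun.of_run P (fun a => hP (S a) (h₁ a) (h₂ a) (h₃ a)) (fun a => ?_)
    (fun a => polynomial_eval_mono P (hn a))
  rw [(exists_horner q).choose_spec]

end Prog
end FourierStep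

namespace FourierStep

open Turing

/-! ### Leading runs of a bit in a word -/

theorem unaryEncodeNat_eq (n : ℕ) : Computability.unaryEncodeNat n = List.replicate n true := by
  induction n with
  | zero => rfl
  | succ n ih => rw [Computability.unaryEncodeNat, ih, List.replicate_succ]

/-- The number of leading bits `c` of a word. -/
def lead (c : Bool) (x : List Bool) : ℕ := (x.takeWhile (· == c)).length

/-- A word after removal of its leading bits `c` and of the following bit. -/
def skipLead (c : Bool) (x : List Bool) : List Bool := x.drop (lead c x + 1)

theorem lead_replicate (c : Bool) (n : ℕ) (x : List Bool) :
    lead c (List.replicate n c ++ (!c) :: x) = n := by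
  induction n with
  | zero => simp [lead]
  | succ n ih =>
    rw [lead] at ih ⊢
    simp only [List.replicate_succ, List.cons_append, List.takeWhile_cons, beq_self_eq_true,
      if_true, List.length_cons, ih]

theorem skipLead_replicate (c : Bool) (n : ℕ) (x : List Bool) :
    skipLead c (List.replicate n c ++ (!c) :: x) = x := by
  rw [skipLead, lead_replicate, List.drop_append]
  simp

theorem lead_le (c : Bool) (x : List Bool) : lead c x ≤ x.length :=
  (List.takeWhile_prefix _).length_le

theorem length_skipLead_le (c : Bool) (x : List Bool) : (skipLead c x).length ≤ x.length := by
  rw [skipLead, List.length_drop]; omega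

/-- A nonempty remainder guarantees that the delimiter after the run was present; with an empty
remainder, the word could also be the run alone. -/
theorem replicate_append_skipLead {c : Bool} {x : List Bool} (h : skipLead c x ≠ []) :
    List.replicate (lead c x) c ++ (!c) :: skipLead c x = x := by
  induction x with
  | nil => simp [skipLead] at h
  | cons b x ih =>
    by_cases hb : b = c
    · subst hb
      have h1 : lead b (b :: x) = lead b x + 1 := by simp [lead]
      have h2 : skipLead b (b :: x) = skipLead b x := by simp [skipLead, h1]
      rw [h2] at h ⊢
      rw [h1, List.replicate_succ, List.cons_append, ih h]
    · have h1 : lead c (b :: x) = 0 := by simp [lead, hb]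
      have h2 : skipLead c (b :: x) = x := by simp [skipLead, h1]
      rw [h1, h2]
      cases b <;> cases c <;> simp_all

/-! ### Parsing, checking and querying a candidate frequency -/

namespace Prog

variable {A : TM2ComputableAux Bool Bool}

/-- The number of zeros, the number of ones and the remainder of a word `0ᶻ 1 1ᵐ 0 w`. -/
def parse (x : List Bool) : ℕ × ℕ × List Bool :=
  (lead false x, lead true (skipLead false x), skipLead true (skipLead false x))

/-- Split the input word `1ⁿ 0 s 0ᶻ 1 1ᵐ 0 w`. -/
def parseProg : Prog Reg :=
  seq (scan .inp .prec true) <|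
  seq (case .inp fun o => bif o == some true then push .bad true else skip) <|
  seq (scan .inp .zer false) <|
  seq (scan .inp .num true) <|
  seq (moveCount .inp .wit .len)
  (case .wit fun o => bif o.isNone then push .bad true else skip)

/-- Violations are recorded on `bad`: a negative sign and an empty remainder. The digits are stored
least significant first, so the `tail` after reversal removes the leading digit of the number, which
only marks the end of the word. -/
theorem polyRun_parseProg :
    PolyRun A (fun a => (encodeNatInt a).length) parseProg
      (fun a => { inp := encodeNatInt a })
      (fun a =>
        let x := parse (Computability.encodeNat a.2.natAbs)
        { prec := List.replicate a.1 true
          zer := List.replicate x.1 true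
          num := List.replicate x.2.1 true
          wit := x.2.2.reverse.tail
          len := List.replicate x.2.2.length true
          bad := (if x.2.2 = [] then [true] else []) ++ if a.2 < 0 then [true] else [] }) := by
  obtain ⟨y, hy⟩ : ∃ y : ℕ × ℤ → List Bool, ∀ a, Computability.encodeNat a.2.natAbs = y a :=
    ⟨_, fun _ => rfl⟩
  obtain ⟨v, hv⟩ : ∃ v : ℕ × ℤ → List Bool, ∀ a, (if a.2 < 0 then [true] else []) = v a :=
    ⟨_, fun _ => rfl⟩
  have hlen : ∀ a : ℕ × ℤ, (y a).length ≤ (encodeNatInt a).length := by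
    intro a
    simp [encodeNatInt, unaryPair, encodeInt, hy]
    omega
  simp only [hy, hv, parse]
  refine PolyRun.seq (S' := fun a : ℕ × ℤ =>
      { inp := encodeInt a.2, prec := List.replicate a.1 true })
    (PolyRun.of_run (2 * Polynomial.X + 1) (fun a => run_scan true (by simp) _) (fun a => ?_)
      (fun a => by simp [Stacks.get])) ?_
  · have h1 := lead_replicate true a.1 (encodeInt a.2)
    have h2 := skipLead_replicate true a.1 (encodeInt a.2)
    simp only [Bool.not_true, lead, skipLead] at h1 h2
    simp only [Stacks.get, encodeNatInt, unaryPair, unaryEncodeNat_eq]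
    rw [h1] at h2 ⊢
    rw [h2]
    simp
  refine PolyRun.seq (S' := fun a : ℕ × ℤ =>
      { inp := y a, prec := List.replicate a.1 true, bad := v a }) ⟨2, fun a => ?_⟩ ?_
  · have hva := hv a
    refine (Run.case (t := 1) ?_).of_eq rfl (by simp)
    by_cases h : a.2 < 0
    · simp only [Stacks.get, encodeInt, h, decide_true, List.head?_cons]
      rw [if_pos h] at hva
      exact (Run.push _ _ _).of_eq (by simp [Stacks.get, hy, ← hva]) le_rfl
    · simp only [Stacks.get, encodeInt, h, decide_false, List.head?_cons]
      rw [if_neg h] at hva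
      exact (Run.skip _).of_eq (by simp [hy, ← hva]) le_rfl
  refine PolyRun.seq (S' := fun a : ℕ × ℤ =>
      { inp := skipLead false (y a), prec := List.replicate a.1 true,
        zer := List.replicate (lead false (y a)) true, bad := v a })
    (PolyRun.of_run (2 * Polynomial.X + 1) (fun a => run_scan false (by simp) _) (fun a => ?_)
      (fun a => by simpa [Stacks.get] using hlen a)) ?_
  · simp [Stacks.get, skipLead, lead]
  refine PolyRun.seq (S' := fun a : ℕ × ℤ =>
      { inp := skipLead true (skipLead false (y a)), prec := List.replicate a.1 true,
        zer := List.replicate (lead false (y a)) true,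
        num := List.replicate (lead true (skipLead false (y a))) true, bad := v a })
    (PolyRun.of_run (2 * Polynomial.X + 1) (fun a => run_scan true (by simp) _) (fun a => ?_)
      (fun a => by simpa [Stacks.get] using (length_skipLead_le _ _).trans (hlen a))) ?_
  · simp [Stacks.get, skipLead, lead]
  refine PolyRun.seq (S' := fun a : ℕ × ℤ =>
      { prec := List.replicate a.1 true, zer := List.replicate (lead false (y a)) true,
        num := List.replicate (lead true (skipLead false (y a))) true,
        wit := (skipLead true (skipLead false (y a))).reverse,
        len := List.replicate (skipLead true (skipLead false (y a))).length true, bad := v a })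
    (PolyRun.of_run (3 * Polynomial.X + 1)
      (fun a => run_moveCount (by simp) (by simp) (by simp) _) (fun a => ?_)
      (fun a => by simpa [Stacks.get] using
        (length_skipLead_le _ _).trans ((length_skipLead_le _ _).trans (hlen a))))
      ⟨2, fun a => ?_⟩
  · simp [Stacks.get]
  · beta_reduce
    generalize skipLead true (skipLead false (y a)) = w
    refine (Run.case (t := 1) ?_).of_eq rfl (by simp)
    rcases List.eq_nil_or_concat w with rfl | ⟨u, b, rfl⟩
    · simp only [Stacks.get, List.reverse_nil, List.head?_nil]
      exact (Run.push _ _ _).of_eq (by simp [Stacks.get]) le_rfl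
    · simp only [Stacks.get, List.concat_eq_append, List.reverse_append, List.reverse_cons,
        List.reverse_nil, List.nil_append, List.cons_append, List.head?_cons]
      exact (Run.skip _).of_eq (by simp) le_rfl

/-- Subtract `z`, `n` and the length of `w` from values of polynomials at `m`. The stack `bad`
remains empty if `z` equals the value, `n` is at least the value, and the length is at most the
value. -/
def checkProg (p L D : Polynomial ℕ) : Prog Reg :=
  seq (evalPoly p) <| seq (sub .len .acc .bad) <| seq (clear .acc) <|
  seq (evalPoly L) <| seq (sub .acc .zer .bad) <| seq (move .zer .bad) <|
  seq (evalPoly D) (sub .acc .prec .bad)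

/-- Comparisons are truncated subtractions in unary. The equality of `z` and `L(m)` takes both
differences. What remains on `prec` is `n - D(m)`, the exponent of the value to be output. -/
theorem polyRun_checkProg (p L D : Polynomial ℕ) {ι : Type} {sz : ι → ℕ} (n z m l : ι → ℕ)
    (w v : ι → List Bool) (hz : ∀ a, z a ≤ sz a) (hm : ∀ a, m a ≤ sz a)
    (hl : ∀ a, l a ≤ sz a) :
    PolyRun A sz (checkProg p L D)
      (fun a => { prec := List.replicate (n a) true, zer := List.replicate (z a) true,
                  num := List.replicate (m a) true, wit := w a,
                  len := List.replicate (l a) true, bad := v a })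
      (fun a => { prec := List.replicate (n a - D.eval (m a)) true,
                  num := List.replicate (m a) true, wit := w a,
                  bad := List.replicate (D.eval (m a) - n a) true ++
                    (List.replicate (z a - L.eval (m a)) true ++
                    (List.replicate (L.eval (m a) - z a) true ++
                    (List.replicate (l a - p.eval (m a)) true ++ v a))) }) := by
  refine PolyRun.seq (polyRun_evalPoly p (fun _ => rfl) (fun _ => rfl) (fun _ => rfl)
    (by simpa using hm)) ?_
  refine PolyRun.seq (S' := fun a =>
      { prec := List.replicate (n a) true, zer := List.replicate (z a) true,
        num := List.replicate (m a) true, wit := w a,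
        acc := List.replicate (p.eval (m a) - l a) true,
        bad := List.replicate (l a - p.eval (m a)) true ++ v a })
    (PolyRun.of_run (3 * Polynomial.X + 1) (fun a => run_sub (by simp) (by simp) (by simp) _)
      (fun a => by simp [Stacks.get]) (fun a => by simpa [Stacks.get] using hl a)) ?_
  refine PolyRun.seq (S' := fun a =>
      { prec := List.replicate (n a) true, zer := List.replicate (z a) true,
        num := List.replicate (m a) true, wit := w a,
        bad := List.replicate (l a - p.eval (m a)) true ++ v a })
    (PolyRun.of_run (2 * p + 1) (fun a => run_clear _ _)
      (fun a => by simp) (fun a => ?_)) ?_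
  · have := polynomial_eval_mono p (hm a)
    simp [Stacks.get]; omega
  refine PolyRun.seq (polyRun_evalPoly L (fun _ => rfl) (fun _ => rfl) (fun _ => rfl)
    (by simpa using hm)) ?_
  refine PolyRun.seq (S' := fun a =>
      { prec := List.replicate (n a) true, zer := List.replicate (z a - L.eval (m a)) true,
        num := List.replicate (m a) true, wit := w a,
        bad := List.replicate (L.eval (m a) - z a) true ++
          (List.replicate (l a - p.eval (m a)) true ++ v a) })
    (PolyRun.of_run (3 * L + 1) (fun a => run_sub (by simp) (by simp) (by simp) _)
      (fun a => by simp [Stacks.get])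
      (fun a => by simpa [Stacks.get] using polynomial_eval_mono L (hm a))) ?_
  refine PolyRun.seq (S' := fun a =>
      { prec := List.replicate (n a) true, num := List.replicate (m a) true, wit := w a,
        bad := List.replicate (z a - L.eval (m a)) true ++
          (List.replicate (L.eval (m a) - z a) true ++
          (List.replicate (l a - p.eval (m a)) true ++ v a)) })
    (PolyRun.of_run (2 * Polynomial.X + 1) (fun a => run_move (by simp) _)
      (fun a => by simp [Stacks.get])
      (fun a => by have := hz a; simp [Stacks.get]; omega)) ?_
  refine PolyRun.seq (polyRun_evalPoly D (fun _ => rfl) (fun _ => rfl) (fun _ => rfl)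
    (by simpa using hm)) ?_
  exact PolyRun.of_run (3 * D + 1) (fun a => run_sub (by simp) (by simp) (by simp) _)
      (fun a => by simp [Stacks.get])
      (fun a => by simpa [Stacks.get] using polynomial_eval_mono D (hm a))

/-- Decide by a call whether the word `1ᵐ 0 w` is accepted, where `w` arises from the word on `wit`
by reversion and removal of the first bit; the empty word on `wit` is always accepted. -/
def queryProg : Prog Reg :=
  seq (move .wit .rev) <|
  seq (case .rev fun o => bif o.isNone then push .res true else skip) <|
  seq (move .num .arg) <| seq (push .arg false) <| seq (move .rev .arg) <|
  seq (call .arg .res)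
  (collect .res .hit)

/-- The call is made in every case, and for an empty word an extra `true` is placed on `res`
beforehand. So `hit` is nonempty exactly if the word is empty or the verifier accepts. The argument
is assembled in reverse because a call reverses it. -/
theorem polyRun_queryProg {χ : List Bool → Bool} {T : Polynomial ℕ}
    (hA : ∀ x, Outputs A x [χ x] (T.eval x.length)) {ι : Type} {sz : ι → ℕ} (m : ι → ℕ)
    (w u v : ι → List Bool) (hm : ∀ a, m a ≤ sz a) (hw : ∀ a, (w a).length ≤ sz a) :
    PolyRun A sz queryProg
      (fun a => { prec := u a, num := List.replicate (m a) true, wit := (w a).reverse, bad := v a })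
      (fun a => { prec := u a, bad := v a,
                  hit := List.replicate ((χ (unaryPair (m a) (w a).tail) ::
                    if w a = [] then [true] else []).count true) true }) := by
  refine PolyRun.seq (S' := fun a =>
      { prec := u a, num := List.replicate (m a) true, rev := w a, bad := v a })
    (PolyRun.of_run (2 * Polynomial.X + 1) (fun a => run_move (by simp) _)
      (fun a => by simp [Stacks.get]) (fun a => by simpa [Stacks.get] using hw a)) ?_
  refine PolyRun.seq (S' := fun a =>
      { prec := u a, num := List.replicate (m a) true, rev := (w a).tail, bad := v a,
        res := if w a = [] then [true] else [] }) ⟨2, fun a => ?_⟩ ?_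
  · refine (Run.case (t := 1) ?_).of_eq rfl (by simp)
    rcases h : w a with _ | ⟨b, l⟩
    · simp only [Stacks.get, h, List.head?_nil]
      exact (Run.push _ _ _).of_eq (by simp [Stacks.get]) le_rfl
    · simp only [Stacks.get, h, List.head?_cons]
      exact (Run.skip _).of_eq (by simp) le_rfl
  refine PolyRun.seq (S' := fun a =>
      { prec := u a, arg := List.replicate (m a) true, rev := (w a).tail, bad := v a,
        res := if w a = [] then [true] else [] })
    (PolyRun.of_run (2 * Polynomial.X + 1) (fun a => run_move (by simp) _)
      (fun a => by simp [Stacks.get]) (fun a => by simpa [Stacks.get] using hm a)) ?_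
  refine PolyRun.seq (S' := fun a =>
      { prec := u a, arg := false :: List.replicate (m a) true, rev := (w a).tail, bad := v a,
        res := if w a = [] then [true] else [] })
    (PolyRun.of_run 1 (fun a => Run.push _ _ _) (fun a => by simp [Stacks.get]) (by simp)) ?_
  refine PolyRun.seq (S' := fun a =>
      { prec := u a, arg := (unaryPair (m a) (w a).tail).reverse, bad := v a,
        res := if w a = [] then [true] else [] })
    (PolyRun.of_run (2 * Polynomial.X + 1) (fun a => run_move (by simp) _)
      (fun a => by simp [Stacks.get, unaryPair, unaryEncodeNat_eq])
      (fun a => by have := hw a; simp [Stacks.get]; omega)) ?_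
  have hlen : ∀ a, (unaryPair (m a) (w a).tail).length ≤ 2 * sz a + 1 := fun a => by
    have h1 := hm a
    have h2 := hw a
    simp [unaryPair, unaryEncodeNat_eq]
    omega
  refine PolyRun.seq (S' := fun a =>
      { prec := u a, bad := v a,
        res := χ (unaryPair (m a) (w a).tail) :: if w a = [] then [true] else [] })
    (PolyRun.of_run (2 * Polynomial.X + 1 + 1 + T.comp (2 * Polynomial.X + 1) + 2)
      (fun a => Run.call (by simp) rfl (hA _))
      (fun a => by simp [Stacks.get]) (fun a => ?_)) ⟨5, fun a => ?_⟩
  · have h1 := polynomial_eval_mono T (hlen a)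
    have h2 := hlen a
    simp
    omega
  · refine (run_collect (by simp) _).of_eq (by simp [Stacks.get]) ?_
    simp only [Stacks.get]
    split_ifs <;> simp

end Prog
end FourierStep

namespace FourierStep

open Turing
namespace Prog

variable {A : TM2ComputableAux Bool Bool}

/-- Output the word `0 0ⁿ 1`, with `n` on `prec`, if `bad` is empty and `hit` is not, and the word
`0` otherwise. -/
def emitProg : Prog Reg :=
  seq (case .bad fun o => bif o.isNone
    then case .hit fun o => bif o.isNone then push .out false
      else seq (push .out true) <| seq (moveMap (fun _ => false) .prec .out) (push .out false)
    else push .out false) <|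
  seq (clear .prec) <| seq (clear .bad) (clear .hit)

/-- The two possible outputs are the encodings of 2ⁿ and 0. The bounds on `u` and `v` pay for
emptying the stacks, as only the output may remain. -/
theorem polyRun_emitProg {ι : Type} {sz : ι → ℕ} (n : ι → ℕ) (u v : ι → List Bool)
    {P Q : Polynomial ℕ} (hn : ∀ a, n a ≤ sz a) (hu : ∀ a, (u a).length ≤ P.eval (sz a))
    (hv : ∀ a, (v a).length ≤ Q.eval (sz a)) :
    PolyRun A sz emitProg
      (fun a => { prec := List.replicate (n a) true, bad := u a, hit := v a })
      (fun a => { out := if u a = [] ∧ v a ≠ [] then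
        false :: (List.replicate (n a) false ++ [true]) else [false] }) := by
  refine PolyRun.seq (S' := fun a =>
      { out := if u a = [] ∧ v a ≠ [] then
          false :: (List.replicate (n a) false ++ [true]) else [false]
        prec := if u a = [] ∧ v a ≠ [] then [] else List.replicate (n a) true
        bad := (u a).tail
        hit := if u a = [] then (v a).tail else v a }) ⟨2 * Polynomial.X + 5, fun a => ?_⟩ ?_
  · refine (Run.case (t := 2 * n a + 4) ?_).of_eq rfl (by have := hn a; simp; omega)
    simp only [Stacks.get]
    rcases hua : u a with _ | ⟨b, l⟩
    · refine (Run.case (t := 2 * n a + 3) ?_).of_eq rfl (by omega)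
      simp only [Stacks.get, Stacks.update_bad]
      rcases hva : v a with _ | ⟨b, l⟩
      · exact (Run.push _ _ _).of_eq (by simp [Stacks.get]) (by omega)
      · refine (Run.seq (Run.push _ _ _) (Run.seq (run_moveMap _ (by simp) _)
          (Run.push _ _ _))).of_eq (by simp [Stacks.get]) ?_
        simp [Stacks.get]
        omega
    · exact (Run.push _ _ _).of_eq (by simp [Stacks.get]) (by omega)
  refine PolyRun.seq (S' := fun a =>
      { out := if u a = [] ∧ v a ≠ [] then
          false :: (List.replicate (n a) false ++ [true]) else [false]
        bad := (u a).tail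
        hit := if u a = [] then (v a).tail else v a })
    (PolyRun.of_run (2 * Polynomial.X + 1) (fun a => run_clear _ _) (fun a => by simp)
      (fun a => ?_)) ?_
  · have := hn a
    simp only [Stacks.get]
    split_ifs
    · simp
    · simp; omega
  refine PolyRun.seq (S' := fun a =>
      { out := if u a = [] ∧ v a ≠ [] then
          false :: (List.replicate (n a) false ++ [true]) else [false]
        hit := if u a = [] then (v a).tail else v a })
    (PolyRun.of_run (2 * P + 1) (fun a => run_clear _ _) (fun a => by simp)
      (fun a => ?_)) ?_
  · have := hu a
    simp [Stacks.get]
    omega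
  refine PolyRun.of_run (2 * Q + 1) (fun a => run_clear _ _) (fun a => by simp) (fun a => ?_)
  have := hv a
  simp only [Stacks.get]
  split_ifs <;> simp <;> omega

theorem get_inp (l : List Bool) :
    ({ inp := l } : Stacks).get = Function.update (fun _ => []) .inp l := by
  funext k; cases k <;> simp [Stacks.get]

theorem get_out (l : List Bool) :
    ({ out := l } : Stacks).get = Function.update (fun _ => []) .out l := by
  funext k; cases k <;> simp [Stacks.get]

theorem PolyRun.polyTime {α β : Type} {ea : α → List Bool} {eb : β → List Bool} {F : α → β}
    {p : Prog Reg} (h : PolyRun A (fun a => (ea a).length) p (fun a => { inp := ea a })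
      (fun a => { out := eb (F a) })) : PolyTime ea eb F := by
  obtain ⟨P, hP⟩ := h
  refine polyTime_of_run A p .inp .out P fun a => ?_
  have := hP a
  rwa [get_inp, get_out] at this

end Prog

open Prog

/-- Serves for the imaginary parts, which are 0, and for the trivial verifier in the case #P₁ ⊆ FP₁.
-/
theorem polyTime_const {α β : Type} (ea : α → List Bool) (eb : β → List Bool) (y : β) :
    PolyTime ea eb (fun _ => y) := by
  have A : TM2ComputableAux Bool Bool := default
  have key : ∀ l : List Bool, ∃ p : Prog Reg, ∃ t, Run A p ({} : Stacks).get
      { out := l : Stacks}.get t := by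
    intro l
    induction l with
    | nil => exact ⟨.skip, 1, Run.skip _⟩
    | cons b l ih =>
      obtain ⟨p, t, h⟩ := ih
      exact ⟨.seq p (.push .out b), t + 1, Run.seq h ((Run.push _ _ _).of_eq (by simp [Stacks.get])
        le_rfl)⟩
  obtain ⟨p, t, h⟩ := key (eb y)
  refine PolyRun.polyTime (A := A) (p := .seq (clear .inp) p) (PolyRun.seq (S' := fun _ => {})
    (PolyRun.of_run (2 * Polynomial.X + 1) (fun a => run_clear _ _) (fun a => by simp)
      (fun a => by simp [Stacks.get])) ⟨Polynomial.C t, fun a => by simpa using h⟩)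

/-! ### Computing the Fourier coefficients -/

theorem encodeInt_zero : encodeInt 0 = [false] := rfl

/-- The hypothesis excludes a zero digit in front of the empty expansion of 0. -/
theorem encodeNat_bit (b : Bool) (n : ℕ) (h : n ≠ 0 ∨ b = true) :
    Computability.encodeNat (Nat.bit b n) = b :: Computability.encodeNat n := by
  simp only [Computability.encodeNat, ← Num.ofNat'_eq, Num.ofNat'_bit]
  have hn : Num.ofNat' n = 0 → n = 0 := fun h => by
    rw [Num.ofNat'_eq] at h
    exact_mod_cast h
  rcases hx : Num.ofNat' n with _ | m
  · cases b
    · exact absurd (hn hx) (by simpa using h)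
    · rfl
  · cases b <;> rfl

theorem encodeNat_two_pow (n : ℕ) :
    Computability.encodeNat (2 ^ n) = List.replicate n false ++ [true] := by
  induction n with
  | zero => rfl
  | succ n ih =>
    have := encodeNat_bit false (2 ^ n) (Or.inl (by positivity))
    rw [Nat.bit_false, ih] at this
    rw [pow_succ', this]
    rfl

theorem encodeInt_two_pow (n : ℕ) :
    encodeInt (2 ^ n) = false :: (List.replicate n false ++ [true]) := by
  have h : (2 ^ n : ℤ).natAbs = 2 ^ n := by simp [Int.natAbs_pow]
  rw [← encodeNat_two_pow, encodeInt, h]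
  simp

/-- The integer `k` is the frequency belonging to the number `m` and a word `w` which is empty or
of the form `b w'` with `1ᵐ 0 w'` accepted by `χ`; the length of `w` is bounded by the polynomial
`p + 1` and the exponent of `2` in `k` is `L`. -/
def IsFreq (χ : List Bool → Bool) (p L : Polynomial ℕ) (k : ℤ) : Prop :=
  let x := parse (Computability.encodeNat k.natAbs)
  0 ≤ k ∧ x.2.2 ≠ [] ∧ x.2.2.length ≤ p.eval x.2.1 + 2 ∧ x.1 = L.eval x.2.1 ∧
    (x.2.2.dropLast = [] ∨ χ (unaryPair x.2.1 x.2.2.dropLast.tail) = true)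

/-- The number `m` belonging to a frequency. -/
def freqIndex (k : ℤ) : ℕ := (parse (Computability.encodeNat k.natAbs)).2.1

open Classical in
/-- Integers `c` such that `c / 2ⁿ` approximates the coefficients `2 ^ (-D m)`. -/
def coeffApprox (χ : List Bool → Bool) (p L D : Polynomial ℕ) (a : ℕ × ℤ) : ℤ :=
  if IsFreq χ p L a.2 ∧ D.eval (freqIndex a.2) ≤ a.1 then 2 ^ (a.1 - D.eval (freqIndex a.2)) else 0

/-- Parse, check, query, emit. The stack `bad` is empty exactly if the sign and shape of `k`, the
length and exponent conditions and `D ≤ n` all hold; `hit` records the answer of the verifier. -/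
theorem polyTime_coeffApprox {χ : List Bool → Bool}
    (hχ : PolyTime id Computability.encodeBool χ) (p L D : Polynomial ℕ) :
    PolyTime encodeNatInt encodeInt (coeffApprox χ p L D) := by
  obtain ⟨⟨A, T, hA⟩⟩ := hχ
  have hA' : ∀ x, Outputs A x [χ x] (T.eval x.length) := fun x => ⟨hA x⟩
  let x := fun a : ℕ × ℤ => parse (Computability.encodeNat a.2.natAbs)
  have hlen : ∀ a : ℕ × ℤ, (Computability.encodeNat a.2.natAbs).length ≤
      (encodeNatInt a).length := by
    intro a
    simp [encodeNatInt, unaryPair, encodeInt]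
    omega
  have hn : ∀ a : ℕ × ℤ, a.1 ≤ (encodeNatInt a).length := by
    intro a
    simp [encodeNatInt, unaryPair, unaryEncodeNat_eq]
  have hz : ∀ a : ℕ × ℤ, (x a).1 ≤
      (encodeNatInt a).length := fun a => (lead_le _ _).trans (hlen a)
  have hm : ∀ a : ℕ × ℤ, (x a).2.1 ≤
      (encodeNatInt a).length :=
    fun a => (lead_le _ _).trans ((length_skipLead_le _ _).trans (hlen a))
  have hl : ∀ a : ℕ × ℤ, (x a).2.2.length ≤
      (encodeNatInt a).length :=
    fun a => (length_skipLead_le _ _).trans ((length_skipLead_le _ _).trans (hlen a))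
  -- The parsed remainder consists of a free bit, a witness of length at most `p` and the final
  -- digit 1, whence `p + 2`.
  refine PolyRun.polyTime (A := A) (p := .seq parseProg <| .seq (checkProg (p + 2) L D) <|
    .seq queryProg emitProg) ?_
  refine PolyRun.seq polyRun_parseProg ?_
  refine PolyRun.seq (polyRun_checkProg (p + 2) L D (fun a => a.1) _ _ _ _ _ hz hm hl) ?_
  have hrev : ∀ l : List Bool, l.reverse.tail = l.dropLast.reverse := by simp
  simp only [hrev]
  refine PolyRun.seq (polyRun_queryProg hA' _ _ _ _ hm
    (fun a => (List.dropLast_prefix _).length_le.trans (hl a))) ?_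
  obtain ⟨P, hP⟩ := polyRun_emitProg (A := A) (sz := fun a : ℕ × ℤ => (encodeNatInt a).length)
    (fun a => a.1 - D.eval (x a).2.1)
    (fun a => List.replicate (D.eval (x a).2.1 - a.1) true ++
        (List.replicate ((x a).1 -
          L.eval (x a).2.1) true ++
        (List.replicate (L.eval (x a).2.1 -
          (x a).1) true ++
        (List.replicate ((x a).2.2.length -
          (p + 2).eval (x a).2.1) true ++
        ((if (x a).2.2 = [] then [true] else []) ++
          if a.2 < 0 then [true] else [])))))
    (fun a => List.replicate
      ((χ (unaryPair (x a).2.1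
        (x a).2.2.dropLast.tail) ::
        if (x a).2.2.dropLast = [] then [true]
          else []).count true) true)
    (P := D + Polynomial.X + L + Polynomial.X + 2) (Q := 2)
    (fun a => (Nat.sub_le _ _).trans (hn a))
    (fun a => by
      have h1 := polynomial_eval_mono D (hm a)
      have h2 := polynomial_eval_mono L (hm a)
      have h3 := hz a
      have h4 := hl a
      have h5 : ((if (x a).2.2 = [] then [true] else []) ++
          if a.2 < 0 then [true] else []).length ≤ 2 := by split_ifs <;> simp
      simp only [List.length_append, List.length_replicate, Polynomial.eval_add, Polynomial.eval_X,
        Polynomial.eval_ofNat] at h5 ⊢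
      omega)
    (fun a => by
      rw [List.length_replicate]
      refine List.count_le_length.trans ?_
      split_ifs <;> simp)
  refine ⟨P, fun a => (hP a).of_eq ?_ le_rfl⟩
  refine congrArg (fun l => ({ out := l } : Stacks).get) ?_
  simp only [x]
  by_cases h : IsFreq χ p L a.2 ∧ D.eval (freqIndex a.2) ≤ a.1
  · have e : coeffApprox χ p L D a = 2 ^ (a.1 - D.eval (freqIndex a.2)) := if_pos h
    rw [e, encodeInt_two_pow, if_pos]
    · rfl
    · obtain ⟨⟨h1, h2, h3, h4, h5⟩, h6⟩ := h
      simp only [freqIndex] at h6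
      constructor
      · simp [h1, h2, h4, h6]
        omega
      · rcases h5 with h5 | h5 <;> simp [h5, List.count_cons]
  · have e : coeffApprox χ p L D a = 0 := if_neg h
    rw [e, encodeInt_zero, if_neg]
    contrapose! h
    obtain ⟨h1, h2⟩ := h
    simp only [List.append_eq_nil_iff, List.replicate_eq_nil_iff, Polynomial.eval_add,
      Polynomial.eval_ofNat] at h1
    obtain ⟨h3, h4, h5, h6, h7, h8⟩ := h1
    refine ⟨⟨?_, ?_, ?_, ?_, ?_⟩, ?_⟩
    · by_contra h; simp [not_le.1 h] at h8
    · intro h; simp [h] at h7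
    · omega
    · omega
    · by_contra! h
      simp [h.1, h.2] at h2
    · simp only [freqIndex]; omega

end FourierStep

namespace FourierStep

open Turing

/-! ### Binary digits -/

/-- The number with given binary digits, least significant digit first. -/
def ofBits : List Bool → ℕ
  | [] => 0
  | b :: l => Nat.bit b (ofBits l)

theorem ofBits_append (l l' : List Bool) :
    ofBits (l ++ l') = ofBits l + 2 ^ l.length * ofBits l' := by
  induction l with
  | nil => simp [ofBits]
  | cons b l ih => simp [ofBits, ih, Nat.bit_val, pow_succ]; ring

theorem ofBits_lt (l : List Bool) : ofBits l < 2 ^ l.length := by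
  induction l with
  | nil => simp [ofBits]
  | cons b l ih => cases b <;> simp [ofBits, Nat.bit_val, pow_succ] <;> omega

theorem ofBits_replicate_false (n : ℕ) : ofBits (List.replicate n false) = 0 := by
  induction n with
  | zero => rfl
  | succ n ih => simp [List.replicate_succ, ofBits, ih]

theorem ofBits_drop (l : List Bool) (j : ℕ) : ofBits (l.drop j) = ofBits l / 2 ^ j := by
  induction j generalizing l with
  | zero => simp
  | succ j ih =>
    cases l with
    | nil => simp [ofBits]
    | cons b l =>
      rw [List.drop_succ_cons, ih, pow_succ', ← Nat.div_div_eq_div_mul]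
      simp [ofBits, Nat.bit_div_two]

theorem ofBits_take (l : List Bool) (j : ℕ) : ofBits (l.take j) = ofBits l % 2 ^ j := by
  rcases le_total l.length j with h | h
  · rw [List.take_of_length_le h, Nat.mod_eq_of_lt]
    exact (ofBits_lt l).trans_le (Nat.pow_le_pow_right two_pos h)
  · conv_rhs => rw [← List.take_append_drop j l, ofBits_append, List.length_take_of_le h]
    rw [Nat.add_mul_mod_self_left, Nat.mod_eq_of_lt]
    simpa [h] using ofBits_lt (l.take j)

theorem ofBits_encodeNat (n : ℕ) : ofBits (Computability.encodeNat n) = n := by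
  induction n using Nat.binaryRec' with
  | zero => rfl
  | bit b n h ih =>
    rw [encodeNat_bit b n (by by_cases hn : n = 0 <;> simp_all), ofBits, ih]

theorem encodeNat_ofBits_append_true (l : List Bool) :
    Computability.encodeNat (ofBits (l ++ [true])) = l ++ [true] := by
  induction l with
  | nil => rfl
  | cons b l ih =>
    rw [List.cons_append, ofBits, encodeNat_bit, ih]
    left
    rw [ofBits_append]
    simp [ofBits]

/-- Canonical expansions end in a digit 1, so re-encoding strips the high-order zeros. -/
theorem encodeNat_ofBits (l : List Bool) :
    Computability.encodeNat (ofBits l) = (l.reverse.dropWhile (!·)).reverse := by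
  induction l using List.reverseRecOn with
  | nil => rfl
  | append_singleton l b ih =>
    cases b with
    | false => rw [ofBits_append]; simpa [ofBits] using ih
    | true => rw [encodeNat_ofBits_append_true]; simp

theorem length_encodeNat_le {n j : ℕ} (h : n < 2 ^ j) :
    (Computability.encodeNat n).length ≤ j := by
  induction n using Nat.binaryRec' generalizing j with
  | zero => simp [Computability.encodeNat, Computability.encodeNum]
  | bit b n hb ih =>
    rw [encodeNat_bit b n (by by_cases hn : n = 0 <;> simp_all)]
    cases j with
    | zero => cases b <;> simp_all [Nat.bit_val]
    | succ j =>
      have : n < 2 ^ j := by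
        rw [Nat.bit_val, pow_succ] at h
        omega
      simpa using ih this

/-! ### Extracting a block of binary digits from the output of a machine -/

open Prog

/-- On input `1ⁿ` call the machine on `1 ^ q(n)`, remove the three first bits of the output and
return the first `b(n)` of the remaining bits, up to the last bit `true`. -/
def extractProg (q b : Polynomial ℕ) : Prog Reg :=
  .seq (move .inp .num) <| .seq (evalPoly q) <| .seq (move .acc .arg) <|
  .seq (.call .arg .res) <| .seq (move .res .rev) <|
  .seq (pushOnes .acc 3) <| .seq (sub .acc .rev .bad) <| .seq (clear .bad) <|
  .seq (evalPoly b) <| .seq (takeMove .acc .rev .wit) <| .seq (clear .rev) <| .seq (clear .num) <|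
  .seq (seek .wit .out) (move .wit .out)

/-- With the least significant digit first, division by 4 drops two digits and reduction modulo 2^b
keeps `b` of them. The size bound `r` controls the length of the output to be processed. -/
theorem polyTime_extract {h : ℕ → ℤ}
    (hh : PolyTime Computability.unaryEncodeNat encodeInt h) (q r b : Polynomial ℕ)
    (hr : ∀ n, (h (q.eval n)).natAbs < 2 ^ r.eval n) :
    PolyTime Computability.unaryEncodeNat Computability.encodeNat
      (fun n => (h (q.eval n)).natAbs / 4 % 2 ^ b.eval n) := by
  obtain ⟨⟨A, T, hA⟩⟩ := hh
  have hA' : ∀ n, Outputs A (List.replicate n true) (encodeInt (h n)) (T.eval n) := fun n => by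
    have := hA n
    simp only [unaryEncodeNat_eq, List.length_replicate] at this
    exact ⟨this⟩
  have hlen : ∀ n, (encodeInt (h (q.eval n))).length ≤ r.eval n + 1 := fun n => by
    simpa [encodeInt] using length_encodeNat_le (hr n)
  refine PolyRun.polyTime (A := A) (p := extractProg q b) ?_
  simp only [unaryEncodeNat_eq, List.length_replicate]
  refine PolyRun.seq (S' := fun n => { num := List.replicate n true })
    (PolyRun.of_run (2 * Polynomial.X + 1) (fun a => run_move (by simp) _)
      (fun a => by simp [Stacks.get]) (fun a => by simp [Stacks.get])) ?_
  refine PolyRun.seq (polyRun_evalPoly q (fun _ => rfl) (fun _ => rfl) (fun _ => rfl)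
    (by simp)) ?_
  refine PolyRun.seq (S' := fun n =>
      { num := List.replicate n true, arg := List.replicate (q.eval n) true })
    (PolyRun.of_run (2 * q + 1) (fun a => run_move (by simp) _)
      (fun a => by simp [Stacks.get]) (fun a => by simp [Stacks.get])) ?_
  refine PolyRun.seq (S' := fun n =>
      { num := List.replicate n true, res := (encodeInt (h (q.eval n))).reverse })
    (PolyRun.of_run (q + 1 + T.comp q + (r + 2))
      (fun n => Run.call (x := List.replicate (q.eval n) true) (by simp)
        (by simp [Stacks.get]) (hA' _))
      (fun a => by simp [Stacks.get]) (fun a => by have := hlen a; simp; omega)) ?_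
  refine PolyRun.seq (S' := fun n =>
      { num := List.replicate n true, rev := encodeInt (h (q.eval n)) })
    (PolyRun.of_run (2 * (r + 1) + 1) (fun a => run_move (by simp) _)
      (fun a => by simp [Stacks.get])
      (fun a => by have := hlen a; simp [Stacks.get]; omega)) ?_
  -- Three bits are to be removed: the sign and the two lowest digits.
  refine PolyRun.seq (S' := fun n =>
      { num := List.replicate n true, rev := encodeInt (h (q.eval n)),
        acc := List.replicate 3 true })
    (PolyRun.of_run 4 (fun a => run_pushOnes _ _ _)
      (fun a => by simp [Stacks.get]) (fun a => by simp)) ?_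
  refine PolyRun.seq (S' := fun n =>
      { num := List.replicate n true, rev := (encodeInt (h (q.eval n))).drop 3,
        bad := List.replicate (3 - (encodeInt (h (q.eval n))).length) true })
    (PolyRun.of_run 10 (fun a => run_sub (by simp) (by simp) (by simp) _)
      (fun a => by simp [Stacks.get]) (fun a => by simp [Stacks.get])) ?_
  refine PolyRun.seq (S' := fun n =>
      { num := List.replicate n true, rev := (encodeInt (h (q.eval n))).drop 3 })
    (PolyRun.of_run 7 (fun a => run_clear _ _)
      (fun a => by simp) (fun a => by simp [Stacks.get]; omega)) ?_
  refine PolyRun.seq (polyRun_evalPoly b (fun _ => rfl) (fun _ => rfl) (fun _ => rfl)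
    (by simp)) ?_
  refine PolyRun.seq (S' := fun n =>
      { num := List.replicate n true,
        rev := ((encodeInt (h (q.eval n))).drop 3).drop (b.eval n)
        wit := (((encodeInt (h (q.eval n))).drop 3).take (b.eval n)).reverse })
    (PolyRun.of_run (3 * b + 1) (fun a => run_takeMove (by simp) (by simp) (by simp) _)
      (fun a => by simp [Stacks.get]) (fun a => by simp [Stacks.get])) ?_
  refine PolyRun.seq (S' := fun n =>
      { num := List.replicate n true,
        wit := (((encodeInt (h (q.eval n))).drop 3).take (b.eval n)).reverse })
    (PolyRun.of_run (2 * (r + 1) + 1) (fun a => run_clear _ _)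
      (fun a => by simp) (fun a => by have := hlen a; simp [Stacks.get]; omega)) ?_
  refine PolyRun.seq (S' := fun n =>
      { wit := (((encodeInt (h (q.eval n))).drop 3).take (b.eval n)).reverse })
    (PolyRun.of_run (2 * Polynomial.X + 1) (fun a => run_clear _ _)
      (fun a => by simp) (fun a => by simp [Stacks.get])) ?_
  -- The stack `wit` has the most significant digit on top. Discarding zeros down to the first 1
  -- makes the expansion canonical, and the last move restores the order.
  have key : ∀ n, Computability.encodeNat ((h (q.eval n)).natAbs / 4 % 2 ^ b.eval n) =
      ((((encodeInt (h (q.eval n))).drop 3).take (b.eval n)).reverse.dropWhile (!·)).reverse := by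
    intro n
    rw [← encodeNat_ofBits, ofBits_take, encodeInt, List.drop_succ_cons, ofBits_drop,
      ofBits_encodeNat]
    norm_num
  have hlen' : ∀ n, (((encodeInt (h (q.eval n))).drop 3).take (b.eval n)).reverse.length ≤
      r.eval n + 1 := fun n => by
    have := hlen n
    simp; omega
  simp only [key]
  generalize hw : (fun n => (((encodeInt (h (q.eval n))).drop 3).take (b.eval n)).reverse) = w
  have hw' : ∀ n, (((encodeInt (h (q.eval n))).drop 3).take (b.eval n)).reverse = w n :=
    fun n => congrFun hw n
  simp only [hw'] at hlen' ⊢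
  refine PolyRun.seq (S' := fun n =>
      { wit := ((w n).dropWhile (!·)).tail, out := ((w n).dropWhile (!·)).head?.toList })
    (PolyRun.of_run (2 * (r + 1) + 1) (fun a => run_seek (by simp) _ rfl)
      (fun a => by simp [Stacks.get]) (fun a => by simpa [Stacks.get] using hlen' a)) ?_
  refine PolyRun.of_run (2 * (r + 1) + 1) (fun a => run_move (by simp) _) (fun a => ?_)
    (fun a => ?_)
  · simp only [Stacks.get, Stacks.update_wit, Stacks.update_out]
    rcases (w a).dropWhile (!·) with _ | ⟨c, l⟩ <;> simp
  · have h1 := hlen' a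
    have h2 := (List.dropWhile_suffix (l := w a) (!·)).length_le
    simp [Stacks.get]
    omega

end FourierStep

namespace FourierStep

open Prog

/-! ### Frequencies -/

/-- The exponent `D` of the coefficients `2 ^ (-D m)`. -/
def coeffExp (p : Polynomial ℕ) : Polynomial ℕ :=
  32 * (Polynomial.X + 1) * (p + Polynomial.X + 1)

/-- The exponent `D (D + 1)` of `2` in the frequencies. -/
def freqExp (p : Polynomial ℕ) : Polynomial ℕ := coeffExp p * (coeffExp p + 1)

theorem le_coeffExp (p : Polynomial ℕ) (m : ℕ) :
    32 * (p.eval m + m + 1) ≤ (coeffExp p).eval m := by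
  simp only [coeffExp, Polynomial.eval_mul, Polynomial.eval_add, Polynomial.eval_X,
    Polynomial.eval_one, Polynomial.eval_ofNat]
  nlinarith [Nat.zero_le (m * (p.eval m + m + 1))]

/-- The gap does two jobs: it puts the masses of earlier blocks above the digits that hold the count
of block `m`, and it makes `D` strictly increasing, so that later frequencies are divisible by the
step count. The constant 32 is generous. -/
theorem coeffExp_add_le (p : Polynomial ℕ) {m m' : ℕ} (h : m' < m) :
    (coeffExp p).eval m' + 32 * (p.eval m + m + 1) ≤ (coeffExp p).eval m := by
  obtain ⟨d, rfl⟩ : ∃ d, m = m' + 1 + d := ⟨m - (m' + 1), by omega⟩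
  have h1 := polynomial_eval_mono p h.le
  simp only [coeffExp, Polynomial.eval_mul, Polynomial.eval_add, Polynomial.eval_X,
    Polynomial.eval_one, Polynomial.eval_ofNat]
  generalize p.eval (m' + 1 + d) = y at *
  generalize p.eval m' = x at *
  have h2 : (m' + 1) * (x + m' + 1) ≤ (m' + 1) * (y + (m' + 1 + d) + 1) :=
    Nat.mul_le_mul le_rfl (by omega)
  have h3 := Nat.zero_le (d * (y + (m' + 1 + d) + 1))
  nlinarith

theorem freqExp_eval (p : Polynomial ℕ) (m : ℕ) :
    (freqExp p).eval m = (coeffExp p).eval m * ((coeffExp p).eval m + 1) := by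
  simp [freqExp]

/-- The frequency `0ᴸ 1 1ᵐ 0 w 1` (least significant digit first) belonging to `m` and `w`. -/
def freq (p : Polynomial ℕ) (m : ℕ) (w : List Bool) : ℕ :=
  ofBits ((List.replicate ((freqExp p).eval m) false ++
    true :: (List.replicate m true ++ false :: w)) ++ [true])

theorem parse_freq (p : Polynomial ℕ) (m : ℕ) (w : List Bool) :
    parse (Computability.encodeNat (freq p m w)) = ((freqExp p).eval m, m, w ++ [true]) := by
  have h1 := lead_replicate false ((freqExp p).eval m)
    (List.replicate m true ++ false :: (w ++ [true]))
  have h2 := skipLead_replicate false ((freqExp p).eval m)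
    (List.replicate m true ++ false :: (w ++ [true]))
  have h3 := lead_replicate true m (w ++ [true])
  have h4 := skipLead_replicate true m (w ++ [true])
  simp only [Bool.not_false, Bool.not_true] at h1 h2 h3 h4
  rw [freq, encodeNat_ofBits_append_true]
  simp only [List.append_assoc, List.cons_append]
  rw [parse, h1, h2, h3, h4]

theorem freq_lt (p : Polynomial ℕ) (m : ℕ) (w : List Bool) :
    freq p m w < 2 ^ ((freqExp p).eval m + m + w.length + 3) := by
  refine (ofBits_lt _).trans_le (Nat.pow_le_pow_right two_pos ?_)
  simp
  omega

theorem freq_pos (p : Polynomial ℕ) (m : ℕ) (w : List Bool) : 0 < freq p m w := by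
  rw [freq, ofBits_append]
  simp [ofBits]

theorem two_pow_dvd_freq (p : Polynomial ℕ) (m : ℕ) (w : List Bool) :
    2 ^ (freqExp p).eval m ∣ freq p m w := by
  rw [freq, List.append_assoc, ofBits_append, ofBits_replicate_false, zero_add,
    List.length_replicate]
  exact Dvd.intro _ rfl

/-- The words which contribute a frequency: the empty word, and the words `b w` such that
`1ᵐ 0 w` is accepted. -/
def words (χ : List Bool → Bool) (p : Polynomial ℕ) (m : ℕ) : Set (List Bool) :=
  {w | w.length ≤ p.eval m + 1 ∧ (w = [] ∨ χ (unaryPair m w.tail) = true)}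

theorem finite_words (χ : List Bool → Bool) (p : Polynomial ℕ) (m : ℕ) :
    (words χ p m).Finite :=
  (List.finite_length_le Bool (p.eval m + 1)).subset fun _ h => h.1

/-- The finite set of words which contribute a frequency. -/
def wordsFinset (χ : List Bool → Bool) (p : Polynomial ℕ) (m : ℕ) : Finset (List Bool) :=
  (finite_words χ p m).toFinset

theorem mem_wordsFinset {χ : List Bool → Bool} {p : Polynomial ℕ} {m : ℕ} {w : List Bool} :
    w ∈ wordsFinset χ p m ↔
      w.length ≤ p.eval m + 1 ∧ (w = [] ∨ χ (unaryPair m w.tail) = true) :=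
  (finite_words χ p m).mem_toFinset

theorem card_wordsFinset_le (χ : List Bool → Bool) (p : Polynomial ℕ) (m : ℕ) :
    (wordsFinset χ p m).card ≤ 2 ^ (p.eval m + 2) := by
  rw [← Finset.card_range (2 ^ (p.eval m + 2))]
  -- The appended 1 protects trailing zeros and makes the map injective.
  refine Finset.card_le_card_of_injOn (fun w => ofBits (w ++ [true])) (fun w hw => ?_)
    (fun w _ w' _ h => ?_)
  · have h := (mem_wordsFinset.1 hw).1
    rw [Finset.coe_range, Set.mem_Iio]
    refine (ofBits_lt _).trans_le (Nat.pow_le_pow_right two_pos ?_)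
    simp
    omega
  · have := congrArg Computability.encodeNat h
    simpa only [encodeNat_ofBits_append_true, List.append_cancel_right_eq] using this

/-- The free first bit doubles the count and the empty word makes it odd. Scaled by 2, this is 2
modulo 4, the middle of a residue range, so an error of 1 in either direction leaves the quotient by
4 intact. -/
theorem card_wordsFinset (χ : List Bool → Bool) (p : Polynomial ℕ) (m : ℕ) :
    (wordsFinset χ p m).card =
      2 * Set.ncard {w : List Bool | w.length ≤ p.eval m ∧ χ (unaryPair m w) = true} + 1 := by
  set W := {w : List Bool | w.length ≤ p.eval m ∧ χ (unaryPair m w) = true} with hW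
  have hfin : W.Finite := (List.finite_length_le Bool (p.eval m)).subset fun _ h => h.1
  have e : words χ p m = insert [] (List.cons true '' W ∪ List.cons false '' W) := by
    ext w
    rcases w with _ | ⟨b, w⟩
    · simp [words]
    · cases b <;> simp [words, hW]
  rw [wordsFinset, ← Set.ncard_eq_toFinset_card _ (finite_words χ p m), e,
    Set.ncard_insert_of_notMem (by simp) ((hfin.image _).union (hfin.image _)),
    Set.ncard_union_eq _ (hfin.image _) (hfin.image _),
    Set.ncard_image_of_injective _ (List.cons_injective), Set.ncard_image_of_injective _
    (List.cons_injective)]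
  · ring
  · rw [Set.disjoint_left]
    rintro _ ⟨a, _, rfl⟩ ⟨b, _, h⟩
    simp at h

theorem encodeNat_ne_append_false (n : ℕ) (l : List Bool) :
    Computability.encodeNat n ≠ l ++ [false] := by
  intro h
  have h1 := encodeNat_ofBits (Computability.encodeNat n)
  rw [ofBits_encodeNat, h] at h1
  have h2 := congrArg List.length h1
  have h3 := (List.dropWhile_suffix (l := l.reverse) (!·)).length_le
  simp at h2 h3
  omega

theorem isFreq_iff {χ : List Bool → Bool} {p : Polynomial ℕ} {k : ℤ} :
    IsFreq χ p (freqExp p) k ↔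
      ∃ w ∈ wordsFinset χ p (freqIndex k), k = freq p (freqIndex k) w := by
  constructor
  · rintro ⟨hk, h1, h2, h3, h4⟩
    have h5 : skipLead false (Computability.encodeNat k.natAbs) ≠ [] := by
      intro h
      apply h1
      simp only [parse, h]
      simp [skipLead]
    have h6 := replicate_append_skipLead h5
    have h7 := replicate_append_skipLead (c := true)
      (x := skipLead false (Computability.encodeNat k.natAbs)) h1
    rw [← h7] at h6
    simp only [parse] at h1 h2 h3 h4
    obtain ⟨w, b, hw⟩ := (List.eq_nil_or_concat _).resolve_left h1
    rw [List.concat_eq_append] at hw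
    rw [hw] at h2 h4 h6
    cases b with
    | false =>
      exact absurd h6.symm (by
        rw [← List.cons_append, ← List.append_assoc, ← List.cons_append, ← List.append_assoc]
        exact encodeNat_ne_append_false _ _)
    | true =>
      simp only [List.dropLast_concat] at h4
      refine ⟨w, mem_wordsFinset.2 ⟨?_, h4⟩, ?_⟩
      · simp at h2
        simpa [freqIndex, parse] using h2
      · have h8 : k.natAbs = freq p (freqIndex k) w := by
          refine ((ofBits_encodeNat k.natAbs).symm.trans (congrArg ofBits h6.symm)).trans ?_
          have h9 : freqIndex k = lead true (skipLead false (Computability.encodeNat k.natAbs)) :=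
            rfl
          rw [freq, h9, ← h3]
          simp only [List.append_assoc, List.cons_append, Bool.not_false, Bool.not_true]
        rw [← h8, Int.natAbs_of_nonneg hk]
  · rintro ⟨w, hw, hk⟩
    rw [mem_wordsFinset] at hw
    have := parse_freq p (freqIndex k) w
    rw [IsFreq, hk, Int.natAbs_natCast, this]
    simp only [List.dropLast_concat]
    refine ⟨by positivity, by simp, by simp; omega, trivial, hw.2⟩

theorem freqIndex_freq (p : Polynomial ℕ) (m : ℕ) (w : List Bool) :
    freqIndex (freq p m w) = m := by
  rw [freqIndex, Int.natAbs_natCast, parse_freq]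

theorem freq_injective {p : Polynomial ℕ} {m : ℕ} : Function.Injective (freq p m) := by
  intro w w' h
  have := parse_freq p m w
  rw [h, parse_freq] at this
  simpa using this.symm

end FourierStep

namespace FourierStep

/-! ### The function -/

/-- The character `exp (2πikt)`. -/
def char (k : ℤ) (t : ℝ) : ℂ := Complex.exp (2 * Real.pi * Complex.I * k * t)

theorem continuous_char (k : ℤ) : Continuous (char k) := by
  unfold char
  fun_prop

theorem char_eq (k : ℤ) (t : ℝ) :
    char k t = Complex.exp (Complex.I * ((2 * Real.pi * k * t : ℝ) : ℂ)) := by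
  rw [char]
  congr 1
  push_cast
  ring

theorem norm_char (k : ℤ) (t : ℝ) : ‖char k t‖ = 1 := by
  rw [char_eq, Complex.norm_exp_I_mul_ofReal]

theorem char_add (k l : ℤ) (t : ℝ) : char k t * char l t = char (k + l) t := by
  rw [char, char, char, ← Complex.exp_add]
  congr 1
  push_cast
  ring

theorem char_zero (t : ℝ) : char 0 t = 1 := by simp [char]

/-- The interval consists of whole periods. -/
theorem integral_char {k : ℤ} (hk : k ≠ 0) (b : ℝ) (hb : ∃ n : ℤ, k * b = n) :
    ∫ t in (0 : ℝ)..b, char k t = 0 := by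
  have hc : 2 * Real.pi * Complex.I * k ≠ 0 := by
    simp [Real.pi_ne_zero, hk]
  obtain ⟨n, hn⟩ := hb
  have hn' : (k : ℂ) * b = n := by exact_mod_cast congrArg (fun x : ℝ => (x : ℂ)) hn
  unfold char
  rw [integral_exp_mul_complex hc]
  have : 2 * Real.pi * Complex.I * k * b = n * (2 * Real.pi * Complex.I) := by
    rw [← hn']
    ring
  rw [this, Complex.exp_int_mul_two_pi_mul_I]
  simp

/-- From |exp(ix) - 1| ≤ |x|, as the phase stays below 2πk/S on the interval. -/
theorem norm_average_char_sub_one_le (k : ℕ) {S : ℕ} (hS : 0 < S) :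
    ‖(S : ℂ) * (∫ t in (0 : ℝ)..(1 / S), char k t) - 1‖ ≤ 2 * Real.pi * k / S := by
  have hS' : (0 : ℝ) < S := by exact_mod_cast hS
  have h0 : (0 : ℝ) ≤ 1 / S := by positivity
  have e : (S : ℂ) * (∫ t in (0 : ℝ)..(1 / S), char k t) - 1 =
      S * ∫ t in (0 : ℝ)..(1 / S), (char k t - 1) := by
    rw [intervalIntegral.integral_sub ((continuous_char _).intervalIntegrable _ _)
      (continuous_const.intervalIntegrable _ _)]
    have : (S : ℂ) ≠ 0 := by exact_mod_cast hS.ne'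
    simp
    field_simp
  have hb : ‖∫ t in (0 : ℝ)..(1 / S), (char k t - 1)‖ ≤
      2 * Real.pi * k / S * |1 / (S : ℝ) - 0| := by
    refine intervalIntegral.norm_integral_le_of_norm_le_const fun t ht => ?_
    rw [Set.uIoc_of_le h0] at ht
    rw [char_eq]
    refine (Real.norm_exp_I_mul_ofReal_sub_one_le).trans ?_
    have h1 : 0 ≤ 2 * Real.pi * (k : ℤ) * t := by
      have := ht.1.le
      have := Real.pi_pos
      positivity
    rw [Real.norm_of_nonneg h1, mul_div_assoc, div_eq_mul_one_div (k : ℝ)]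
    have := ht.2
    have := Real.pi_pos
    push_cast
    rw [mul_assoc (2 * Real.pi)]
    gcongr
  rw [e, norm_mul, Complex.norm_natCast]
  refine (mul_le_mul_of_nonneg_left hb hS'.le).trans_eq ?_
  rw [sub_zero, abs_of_nonneg h0]
  field_simp

variable (χ : List Bool → Bool) (p : Polynomial ℕ)

/-- The part of the function whose frequencies belong to `m`. -/
def block (m : ℕ) (t : ℝ) : ℂ :=
  ((2 : ℂ) ^ (coeffExp p).eval m)⁻¹ * ∑ w ∈ wordsFinset χ p m, char (freq p m w) t

/-- The continuous function with frequencies `freq p m w` and coefficients `2 ^ (-D m)`. -/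
def sumBlocks (t : ℝ) : ℂ := ∑' m, block χ p m t

/-- The sum of the coefficients of a block. -/
def blockMass (m : ℕ) : ℝ := ((2 : ℝ) ^ (coeffExp p).eval m)⁻¹ * (wordsFinset χ p m).card

theorem blockMass_nonneg (m : ℕ) : 0 ≤ blockMass χ p m := by
  unfold blockMass
  positivity

/-- One factor is summable with total 1; the other makes the tail beyond `j` at most 2^(-j). -/
theorem blockMass_le (m : ℕ) : blockMass χ p m ≤ ((2 : ℝ) ^ m)⁻¹ * (1 / 2 / 2 ^ m) := by
  have h1 : ((wordsFinset χ p m).card : ℝ) ≤ 2 ^ (p.eval m + 2) := by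
    exact_mod_cast card_wordsFinset_le χ p m
  have h2 : (2 : ℝ) ^ (p.eval m + 2 + (2 * m + 1)) ≤ 2 ^ (coeffExp p).eval m := by
    have := le_coeffExp p m
    exact pow_le_pow_right₀ one_le_two (by omega)
  have h3 : ((2 : ℝ) ^ m)⁻¹ * (1 / 2 / 2 ^ m) = (2 ^ (2 * m + 1))⁻¹ := by
    rw [pow_succ, two_mul, pow_add]
    field_simp
  rw [h3, blockMass, inv_mul_le_iff₀ (by positivity), ← div_eq_mul_inv, le_div_iff₀ (by positivity)]
  refine le_trans ?_ h2
  rw [pow_add 2 (p.eval m + 2)]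
  gcongr

theorem blockMass_le' (m : ℕ) : blockMass χ p m ≤ 1 / 2 / 2 ^ m := by
  refine (blockMass_le χ p m).trans (mul_le_of_le_one_left (by positivity) ?_)
  exact inv_le_one_of_one_le₀ (one_le_pow₀ one_le_two)

theorem summable_blockMass : Summable (blockMass χ p) :=
  Summable.of_nonneg_of_le (blockMass_nonneg χ p) (blockMass_le' χ p)
    (summable_geometric_two' 1)

/-- A bound for a part of a block, or of its images under linear functionals. -/
theorem norm_coeff_mul_sum_le (m : ℕ) {u : List Bool → ℂ} {C : ℝ}
    (hu : ∀ w ∈ wordsFinset χ p m, ‖u w‖ ≤ C) :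
    ‖((2 : ℂ) ^ (coeffExp p).eval m)⁻¹ * ∑ w ∈ wordsFinset χ p m, u w‖ ≤ C * blockMass χ p m := by
  rw [norm_mul, norm_inv, norm_pow, Complex.norm_two, blockMass]
  calc ((2 : ℝ) ^ (coeffExp p).eval m)⁻¹ * ‖∑ w ∈ wordsFinset χ p m, u w‖
      ≤ ((2 : ℝ) ^ (coeffExp p).eval m)⁻¹ * ∑ w ∈ wordsFinset χ p m, C := by
        gcongr
        exact norm_sum_le_of_le _ hu
    _ = _ := by rw [Finset.sum_const, nsmul_eq_mul]; ring

theorem norm_block_le (m : ℕ) (t : ℝ) : ‖block χ p m t‖ ≤ blockMass χ p m := by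
  have := norm_coeff_mul_sum_le χ p m (u := fun w => char (freq p m w) t) (C := 1)
    (fun w _ => (norm_char _ _).le)
  rwa [one_mul] at this

theorem continuous_block (m : ℕ) : Continuous (block χ p m) := by
  unfold block
  have := fun w => continuous_char (freq p m w)
  fun_prop

theorem continuous_sumBlocks : Continuous (sumBlocks χ p) :=
  continuous_tsum (continuous_block χ p) (summable_blockMass χ p)
    (fun m t => norm_block_le χ p m t)

theorem hasSum_block (t : ℝ) : HasSum (fun m => block χ p m t) (sumBlocks χ p t) :=
  (Summable.of_norm_bounded (summable_blockMass χ p) (fun m => norm_block_le χ p m t)).hasSum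

theorem norm_sumBlocks_le (t : ℝ) : ‖sumBlocks χ p t‖ ≤ ∑' m, blockMass χ p m :=
  tsum_of_norm_bounded (summable_blockMass χ p).hasSum (fun m => norm_block_le χ p m t)

theorem memLp_sumBlocks : MemLp (sumBlocks χ p) 2 unitMeasure :=
  MemLp.of_bound (continuous_sumBlocks χ p).aestronglyMeasurable _
    (Filter.Eventually.of_forall (norm_sumBlocks_le χ p))

/-- The square-integrable function with frequencies `freq p m w` and coefficients `2 ^ (-D m)`. -/
def witnessFun : L2Unit := (memLp_sumBlocks χ p).toLp

theorem witnessFun_ae : witnessFun χ p =ᵐ[unitMeasure] sumBlocks χ p := MemLp.coeFn_toLp _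

/-- Integration term by term. -/
theorem hasSum_integral_mul (μ : Measure ℝ) [IsFiniteMeasure μ] (g : ℝ → ℂ) (hg : Continuous g)
    (hg' : ∀ t, ‖g t‖ ≤ 1) :
    HasSum (fun m => ((2 : ℂ) ^ (coeffExp p).eval m)⁻¹ *
        ∑ w ∈ wordsFinset χ p m, ∫ t, g t * char (freq p m w) t ∂μ)
      (∫ t, g t * sumBlocks χ p t ∂μ) := by
  have hchar : ∀ k, Integrable (fun t => g t * char k t) μ := fun k =>
    Integrable.of_bound (hg.mul (continuous_char k)).aestronglyMeasurable 1
      (Filter.Eventually.of_forall fun t => by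
        rw [norm_mul, norm_char, mul_one]; exact hg' t)
  have hblock : ∀ m, Integrable (fun t => g t * block χ p m t) μ := fun m =>
    Integrable.of_bound (hg.mul (continuous_block χ p m)).aestronglyMeasurable (blockMass χ p m)
      (Filter.Eventually.of_forall fun t => by
        rw [norm_mul]
        exact (mul_le_of_le_one_left (norm_nonneg _) (hg' t)).trans (norm_block_le χ p m t))
  have h := hasSum_integral_of_summable_integral_norm hblock (by
    refine Summable.of_nonneg_of_le (fun m => integral_nonneg fun t => norm_nonneg _) (fun m => ?_)
      ((summable_blockMass χ p).mul_left (μ.real Set.univ))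
    have : ∫ t, ‖g t * block χ p m t‖ ∂μ ≤ ∫ _, blockMass χ p m ∂μ := by
      refine integral_mono (hblock m).norm (integrable_const _) fun t => ?_
      simp only [norm_mul]
      exact (mul_le_of_le_one_left (norm_nonneg _) (hg' t)).trans (norm_block_le χ p m t)
    simpa using this)
  convert! h using 1
  · funext m
    rw [← integral_finsetSum _ (fun w _ => hchar _), ← integral_const_mul]
    congr 1
    funext t
    rw [block, ← Finset.mul_sum]
    ring
  · congr 1
    funext t
    rw [tsum_mul_left, sumBlocks]

theorem integral_char_mul_char (k l : ℤ) :
    ∫ t, char (-k) t * char l t ∂unitMeasure = if l = k then 1 else 0 := by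
  simp only [char_add]
  rw [integral_Icc_eq_integral_Ioc, ← intervalIntegral.integral_of_le zero_le_one]
  split_ifs with h
  · simp [h, char_zero]
  · exact integral_char (by omega) 1 ⟨-k + l, by simp⟩

theorem hasSum_fourierCoeff (k : ℤ) :
    HasSum (fun m => ((2 : ℂ) ^ (coeffExp p).eval m)⁻¹ *
      ∑ w ∈ wordsFinset χ p m, if (freq p m w : ℤ) = k then 1 else 0)
      (fourierCoeff (witnessFun χ p) k) := by
  have h := hasSum_integral_mul χ p unitMeasure (char (-k)) (continuous_char _)
    (fun t => (norm_char _ _).le)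
  simp only [integral_char_mul_char] at h
  convert! h using 1
  rw [fourierCoeff]
  refine integral_congr_ae ?_
  filter_upwards [witnessFun_ae χ p] with t ht
  rw [ht, char]
  congr 2
  push_cast
  ring

-- A frequency determines its block through `freqIndex` and its word by injectivity, so at most one
-- term of the double sum survives.
open Classical in
theorem fourierCoeff_witnessFun (k : ℤ) :
    fourierCoeff (witnessFun χ p) k =
      if IsFreq χ p (freqExp p) k then ((2 : ℂ) ^ (coeffExp p).eval (freqIndex k))⁻¹ else 0 := by
  rw [← (hasSum_fourierCoeff χ p k).tsum_eq, tsum_eq_single (freqIndex k) (fun m hm => ?_)]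
  · split_ifs with h
    · obtain ⟨w, hw, hk⟩ := isFreq_iff.1 h
      rw [Finset.sum_eq_single_of_mem w hw (fun w' _ h' => ?_)]
      · rw [if_pos hk.symm, mul_one]
      · rw [if_neg]
        intro h''
        exact h' (freq_injective (Nat.cast_injective (h''.trans hk)))
    · rw [Finset.sum_eq_zero, mul_zero]
      intro w hw
      rw [if_neg]
      intro hk
      exact h (isFreq_iff.2 ⟨w, hw, hk.symm⟩)
  · rw [Finset.sum_eq_zero, mul_zero]
    intro w hw
    rw [if_neg]
    rintro rfl
    exact hm (freqIndex_freq p m w).symm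

end FourierStep

namespace FourierStep

variable (χ : List Bool → Bool) (p : Polynomial ℕ)

/-! ### Fourier-computability -/

/-- The approximation is exact once `n ≥ D`; below that the coefficient 2^(-D) is less than 2^(-n),
and 0 suffices. -/
theorem norm_fourierCoeff_sub_coeffApprox_le (k : ℤ) (n : ℕ) :
    ‖fourierCoeff (witnessFun χ p) k -
      (coeffApprox χ p (freqExp p) (coeffExp p) (n, k) : ℂ) / 2 ^ n‖ ≤ (2 ^ n : ℝ)⁻¹ := by
  rw [fourierCoeff_witnessFun, coeffApprox]
  by_cases h : IsFreq χ p (freqExp p) k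
  · rw [if_pos h]
    by_cases h' : (coeffExp p).eval (freqIndex k) ≤ n
    · rw [if_pos ⟨h, h'⟩]
      have : (2 : ℂ) ^ n =
          2 ^ (coeffExp p).eval (freqIndex k) * 2 ^ (n - (coeffExp p).eval (freqIndex k)) := by
        rw [← pow_add, Nat.add_sub_cancel' h']
      rw [this]
      push_cast
      field_simp
      simp
    · rw [if_neg (fun h'' => h' h''.2)]
      simp only [Int.cast_zero, zero_div, sub_zero, norm_inv, norm_pow, Complex.norm_two]
      gcongr
      · exact one_le_two
      · omega
  · rw [if_neg h, if_neg (fun h' => h h'.1)]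
    simp

theorem fourierPartialSum_eq_sum (K : ℕ) (t : ℝ) :
    fourierPartialSum (witnessFun χ p) K t =
      ∑ k ∈ Finset.Icc (-(K : ℤ)) K, fourierCoeff (witnessFun χ p) k * char k t := rfl

theorem hasSum_fourierPartialSum (K : ℕ) (t : ℝ) :
    HasSum (fun m => ((2 : ℂ) ^ (coeffExp p).eval m)⁻¹ *
      ∑ w ∈ wordsFinset χ p m, if freq p m w ≤ K then char (freq p m w) t else 0)
      (fourierPartialSum (witnessFun χ p) K t) := by
  have h := hasSum_sum (s := Finset.Icc (-(K : ℤ)) K) fun k _ =>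
    (hasSum_fourierCoeff χ p k).mul_right (char k t)
  rw [fourierPartialSum_eq_sum]
  convert! h using 1
  funext m
  simp only [mul_assoc, ← Finset.mul_sum, Finset.sum_mul]
  rw [Finset.sum_comm]
  congr 1
  refine Finset.sum_congr rfl fun w _ => ?_
  simp only [ite_mul, one_mul, zero_mul]
  rw [Finset.sum_ite_eq]
  simp only [Finset.mem_Icc, Nat.cast_le]
  congr 1
  simp only [eq_iff_iff]
  constructor
  · intro h; exact ⟨by have := Int.natCast_nonneg (freq p m w); omega, h⟩
  · exact fun h => h.2

/-- A polynomial bound for the binary length of the frequencies. -/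
def freqLength (p : Polynomial ℕ) : Polynomial ℕ := freqExp p + Polynomial.X + p + 4

theorem freq_lt_freqLength {m : ℕ} {w : List Bool} (hw : w ∈ wordsFinset χ p m) :
    freq p m w < 2 ^ (freqLength p).eval m := by
  refine (freq_lt p m w).trans_le (Nat.pow_le_pow_right two_pos ?_)
  have := (mem_wordsFinset.1 hw).1
  simp [freqLength]
  omega

/-- Blocks up to `j` are contained in the partial sum and cancel. Each later block contributes at
most its mass, uniformly in `t`; on an interval of length 1 this also bounds the L² norm. -/
theorem norm_sumBlocks_sub_fourierPartialSum_le (j : ℕ) (t : ℝ) :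
    ‖sumBlocks χ p t - fourierPartialSum (witnessFun χ p) (2 ^ (freqLength p).eval j) t‖ ≤
      ((2 : ℝ) ^ j)⁻¹ := by
  have h := (hasSum_block χ p t).sub (hasSum_fourierPartialSum χ p (2 ^ (freqLength p).eval j) t)
  rw [← h.tsum_eq]
  have h2 := (hasSum_geometric_two' 1).mul_left ((2 : ℝ) ^ j)⁻¹
  rw [mul_one] at h2
  refine tsum_of_norm_bounded h2 fun m => ?_
  rw [block, ← mul_sub, ← Finset.sum_sub_distrib]
  rcases le_or_gt m j with hm | hm
  · rw [Finset.sum_eq_zero, mul_zero, norm_zero]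
    · positivity
    · intro w hw
      have := (freq_lt_freqLength χ p hw).le.trans
        (Nat.pow_le_pow_right two_pos (polynomial_eval_mono (freqLength p) hm))
      rw [if_pos this, sub_self]
  · refine (norm_coeff_mul_sum_le χ p m (C := 1) fun w _ => ?_).trans ?_
    · split_ifs <;> simp [norm_char]
    · rw [one_mul]
      refine (blockMass_le χ p m).trans ?_
      gcongr
      exact one_le_two

theorem fourierPolyTime_witnessFun (hχ : PolyTime id Computability.encodeBool χ) :
    FourierPolyTime (witnessFun χ p) := by
  refine ⟨⟨fun k n => ⟨coeffApprox χ p (freqExp p) (coeffExp p) (n, k), 0⟩, fun k n => ?_,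
    polyTime_coeffApprox hχ p _ _, polyTime_const _ _ 0⟩, freqLength p, fun j => ?_⟩
  · have := norm_fourierCoeff_sub_coeffApprox_le χ p k n
    simpa [GaussianInt.toComplex_def] using this
  · refine (eLpNorm_le_of_ae_bound (C := ((2 : ℝ) ^ j)⁻¹) ?_).trans ?_
    · filter_upwards [witnessFun_ae χ p] with t ht
      rw [ht]
      exact norm_sumBlocks_sub_fourierPartialSum_le χ p j t
    · simp

/-! ### Step averages -/

theorem hasSum_stepAverage {S : ℕ} (hS : 0 < S) :
    HasSum (fun m => ((2 : ℂ) ^ (coeffExp p).eval m)⁻¹ *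
        ∑ w ∈ wordsFinset χ p m, (S : ℂ) * ∫ t in (0 : ℝ)..(1 / S), char (freq p m w) t)
      (stepAverage (witnessFun χ p) S 0) := by
  have h0 : (0 : ℝ) ≤ 1 / S := by positivity
  have h1 : (1 : ℝ) / S ≤ 1 := by
    rw [div_le_one (by exact_mod_cast hS)]
    exact_mod_cast hS
  have h := (hasSum_integral_mul χ p (volume.restrict (Set.Ioc (0 : ℝ) (1 / S))) (fun _ => 1)
    continuous_const (by simp)).mul_left (S : ℂ)
  simp only [one_mul] at h
  convert! h using 1
  · funext m
    simp only [intervalIntegral.integral_of_le h0]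
    rw [← Finset.mul_sum]
    ring
  · rw [stepAverage]
    simp only [Nat.cast_zero, zero_div, zero_add]
    rw [intervalIntegral.integral_of_le h0]
    congr 1
    refine integral_congr_ae ?_
    refine ae_restrict_of_ae_restrict_of_subset ?_ (witnessFun_ae χ p)
    exact Set.Ioc_subset_Icc_self.trans (Set.Icc_subset_Icc le_rfl h1)

/-- With D = D(m) < D' = D(m'), the exponent of 2 in the frequency is D'(D'+1) ≥ (D+1)(D+2), the
exponent of the step count. -/
theorem average_char_freq_eq_zero {m m' : ℕ} (h : m < m') (w : List Bool) :
    ∫ t in (0 : ℝ)..(1 / (2 ^ (((coeffExp p).eval m + 1) ^ 2 + ((coeffExp p).eval m + 1)) : ℕ)),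
      char (freq p m' w) t = 0 := by
  refine integral_char (by have := freq_pos p m' w; omega) _ ?_
  have h1 := coeffExp_add_le p h
  have h2 : 2 ^ (((coeffExp p).eval m + 1) ^ 2 + ((coeffExp p).eval m + 1)) ∣ freq p m' w := by
    refine (pow_dvd_pow 2 ?_).trans (two_pow_dvd_freq p m' w)
    rw [freqExp_eval]
    nlinarith
  obtain ⟨c, hc⟩ := h2
  refine ⟨c, ?_⟩
  rw [hc]
  push_cast
  field_simp

/-- The step averages are close to the partial sums of the masses of the blocks. -/
theorem norm_stepAverage_sub_le (m : ℕ) :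
    ‖stepAverage (witnessFun χ p)
        (2 ^ (((coeffExp p).eval m + 1) ^ 2 + ((coeffExp p).eval m + 1))) 0 -
      ((∑ i ∈ Finset.range (m + 1), blockMass χ p i : ℝ) : ℂ)‖ ≤
      ((2 : ℝ) ^ ((coeffExp p).eval m + 1))⁻¹ / 2 := by
  set D := (coeffExp p).eval m with hD
  set S := 2 ^ ((D + 1) ^ 2 + (D + 1)) with hS
  have hS0 : 0 < S := by positivity
  have hε : ∀ i ∈ Finset.range (m + 1), ∀ w ∈ wordsFinset χ p i,
      2 * Real.pi * freq p i w / S ≤ ((2 : ℝ) ^ (D + 1))⁻¹ / 2 := by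
    intro i hi w hw
    have h1 := (freq_lt_freqLength χ p hw).le.trans (Nat.pow_le_pow_right two_pos
      (polynomial_eval_mono (freqLength p) (Nat.lt_succ_iff.1 (Finset.mem_range.1 hi))))
    -- The 3 accounts for 2π ≤ 8 and D + 2 for the precision. As the length is D(D+1) + m + p(m) +
    -- 4, the claim amounts to m + p(m) + 7 ≤ D.
    have h2 : (freqLength p).eval m + 3 + (D + 2) ≤ (D + 1) ^ 2 + (D + 1) := by
      have := le_coeffExp p m
      simp only [freqLength, Polynomial.eval_add, Polynomial.eval_X, Polynomial.eval_ofNat,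
        freqExp_eval, ← hD] at this ⊢
      nlinarith
    have h3 : (freq p i w : ℝ) ≤ 2 ^ (freqLength p).eval m := by exact_mod_cast h1
    have h4 : 2 * Real.pi ≤ 2 ^ 3 := by have := Real.pi_le_four; linarith
    have h5 : ((2 : ℝ) ^ (D + 1))⁻¹ / 2 = (2 ^ (D + 2))⁻¹ := by
      rw [pow_succ 2 (D + 1)]; field_simp
    rw [h5, div_le_iff₀ (by exact_mod_cast hS0), ← div_eq_inv_mul, le_div_iff₀ (by positivity)]
    calc 2 * Real.pi * freq p i w * 2 ^ (D + 2)
        ≤ 2 ^ 3 * 2 ^ (freqLength p).eval m * 2 ^ (D + 2) := by gcongr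
      _ = 2 ^ ((freqLength p).eval m + 3 + (D + 2)) := by rw [← pow_add, ← pow_add]; ring_nf
      _ ≤ 2 ^ ((D + 1) ^ 2 + (D + 1)) := pow_le_pow_right₀ one_le_two h2
      _ = S := by rw [hS]; push_cast; rfl
  have h := hasSum_stepAverage χ p hS0
  have e : stepAverage (witnessFun χ p) S 0 = ∑ i ∈ Finset.range (m + 1),
      ((2 : ℂ) ^ (coeffExp p).eval i)⁻¹ *
        ∑ w ∈ wordsFinset χ p i, (S : ℂ) * ∫ t in (0 : ℝ)..(1 / S), char (freq p i w) t := by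
    rw [← h.tsum_eq]
    refine tsum_eq_sum fun i hi => ?_
    rw [Finset.sum_eq_zero, mul_zero]
    intro w _
    rw [hS, hD, average_char_freq_eq_zero p (by simpa using hi), mul_zero]
  rw [e]
  push_cast
  rw [← Finset.sum_sub_distrib]
  -- The error is weighted by the mass of each block, and the bounds 1/2/2^i on the masses add up to
  -- at most 1.
  have hterm : ∀ i ∈ Finset.range (m + 1), ‖((2 : ℂ) ^ (coeffExp p).eval i)⁻¹ *
      (∑ w ∈ wordsFinset χ p i, (S : ℂ) * ∫ t in (0 : ℝ)..(1 / S), char (freq p i w) t) -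
      (blockMass χ p i : ℂ)‖ ≤ ((2 : ℝ) ^ (D + 1))⁻¹ / 2 * (1 / 2 / 2 ^ i) := by
    intro i hi
    have e1 : (blockMass χ p i : ℂ) =
        ((2 : ℂ) ^ (coeffExp p).eval i)⁻¹ * ∑ w ∈ wordsFinset χ p i, 1 := by
      simp [blockMass]
    rw [e1, ← mul_sub, ← Finset.sum_sub_distrib]
    refine (norm_coeff_mul_sum_le χ p i (C := ((2 : ℝ) ^ (D + 1))⁻¹ / 2) fun w hw => ?_).trans ?_
    · exact (norm_average_char_sub_one_le _ hS0).trans (hε i hi w hw)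
    · gcongr
      exact blockMass_le' χ p i
  refine (norm_sum_le_of_le _ hterm).trans ?_
  rw [← Finset.mul_sum]
  refine mul_le_of_le_one_right (by positivity) ?_
  exact sum_le_hasSum _ (fun i _ => by positivity) (hasSum_geometric_two' 1)

end FourierStep

/-! ### Recovering the count from a step average -/

namespace FourierStep

variable (χ : List Bool → Bool) (p : Polynomial ℕ)

/-- The number of words accepted by `χ`, whose length is bounded by `p`. -/
def countWords (m : ℕ) : ℕ :=
  Set.ncard {w : List Bool | w.length ≤ p.eval m ∧ χ (unaryPair m w) = true}

/-- Ensures that reduction modulo 2^(p(m)+1) returns the count itself. -/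
theorem countWords_lt (m : ℕ) : countWords χ p m < 2 ^ (p.eval m + 1) := by
  have h := card_wordsFinset_le χ p m
  rw [card_wordsFinset, pow_succ] at h
  rw [countWords]
  omega

theorem sum_blockMass_le_one (m : ℕ) : ∑ i ∈ Finset.range (m + 1), blockMass χ p i ≤ 1 :=
  (Finset.sum_le_sum fun i _ => blockMass_le' χ p i).trans
    (sum_le_hasSum _ (fun i _ => by positivity) (hasSum_geometric_two' 1))

/-- The binary digits of the sum of the masses contain the number of accepted words. -/
theorem exists_sum_blockMass_eq (m : ℕ) : ∃ y : ℕ,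
    (2 : ℝ) ^ ((coeffExp p).eval m + 1) * ∑ i ∈ Finset.range (m + 1), blockMass χ p i =
      ((4 * (countWords χ p m + 2 ^ (p.eval m + 1) * y) + 2 : ℕ) : ℝ) := by
  -- By the growth of `D`, earlier blocks only affect digits above those of the count.
  have h : ∀ i ∈ Finset.range m, ∃ z : ℕ,
      (2 : ℝ) ^ ((coeffExp p).eval m + 1) * blockMass χ p i =
        ((4 * 2 ^ (p.eval m + 1) * z : ℕ) : ℝ) := by
    intro i hi
    have h1 := coeffExp_add_le p (Finset.mem_range.1 hi)
    obtain ⟨d, hd⟩ : ∃ d, (coeffExp p).eval m = (coeffExp p).eval i + (p.eval m + 2) + d :=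
      ⟨_, (Nat.add_sub_cancel' (by omega)).symm⟩
    refine ⟨2 ^ d * (wordsFinset χ p i).card, ?_⟩
    rw [blockMass, hd]
    push_cast
    field_simp
    ring
  choose! z hz using h
  refine ⟨∑ i ∈ Finset.range m, z i, ?_⟩
  rw [Finset.mul_sum, Finset.sum_range_succ, Finset.sum_congr rfl hz, blockMass, card_wordsFinset,
    ← countWords, mul_add, Finset.mul_sum]
  push_cast
  rw [pow_succ 2 ((coeffExp p).eval m), mul_add, Finset.mul_sum]
  field_simp
  ring

/-- Query at precision D(m) + 1, which is polynomial in `m`, and read the count off the digits of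
the real part; the imaginary part is not needed. -/
theorem countWords_mem_classFP1
    (h : FirstStepPolyTime (witnessFun χ p) (fun n => 2 ^ (n ^ 2 + n))) :
    countWords χ p ∈ classFP1 := by
  obtain ⟨h, h1, h2, -⟩ := h
  have key : ∀ m, ∃ y : ℕ, ∃ δ : ℤ, |δ| ≤ 1 ∧ (h ((coeffExp p).eval m + 1)).re =
      4 * (countWords χ p m + 2 ^ (p.eval m + 1) * y) + 2 + δ ∧
      4 * (countWords χ p m + 2 ^ (p.eval m + 1) * y) + 2 ≤ 2 ^ ((coeffExp p).eval m + 1) := by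
    intro m
    obtain ⟨y, hy⟩ := exists_sum_blockMass_eq χ p m
    have h3 := h1 ((coeffExp p).eval m + 1)
    have h4 := norm_stepAverage_sub_le χ p m
    have h5 := sum_blockMass_le_one χ p m
    set N := (coeffExp p).eval m + 1
    set V := ∑ i ∈ Finset.range (m + 1), blockMass χ p i
    have hN : (0 : ℝ) < 2 ^ N := by positivity
    -- One unit from the approximation and half a unit from the averages. Since 3/2 < 2, the integer
    -- deviation `δ` is at most 1 in absolute value.
    have h6 : ‖(V : ℂ) - (h N : ℂ) / 2 ^ N‖ ≤ 3 / 2 * (2 ^ N : ℝ)⁻¹ := by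
      have := norm_sub_le_norm_sub_add_norm_sub (V : ℂ)
        (stepAverage (witnessFun χ p) (2 ^ (N ^ 2 + N)) 0) ((h N : ℂ) / 2 ^ N)
      rw [norm_sub_rev] at h4
      linarith
    have h7 : ((V : ℂ) - (h N : ℂ) / 2 ^ N).re = V - (h N).re / 2 ^ N := by
      have : (h N : ℂ) / 2 ^ N = (h N : ℂ) / ((2 ^ N : ℝ) : ℂ) := by push_cast; rfl
      rw [Complex.sub_re, this, Complex.div_ofReal_re]
      simp
    have h8 := (Complex.abs_re_le_norm _).trans h6
    rw [h7] at h8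
    have h9 : |2 ^ N * V - (h N).re| ≤ 3 / 2 := by
      have : 2 ^ N * V - (h N).re = 2 ^ N * (V - (h N).re / 2 ^ N) := by field_simp
      rw [this, abs_mul, abs_of_pos hN]
      calc 2 ^ N * |V - (h N).re / 2 ^ N| ≤ 2 ^ N * (3 / 2 * (2 ^ N : ℝ)⁻¹) := by gcongr
        _ = 3 / 2 := by field_simp
    rw [hy] at h9
    refine ⟨y, (h N).re - (4 * (countWords χ p m + 2 ^ (p.eval m + 1) * y) + 2 : ℕ), ?_, ?_, ?_⟩
    · have : |(((h N).re - (4 * (countWords χ p m + 2 ^ (p.eval m + 1) * y) + 2 : ℕ) : ℤ) : ℝ)| <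
          2 := by
        rw [Int.cast_sub, Int.cast_natCast, abs_sub_comm]
        linarith
      have : |((h N).re - (4 * (countWords χ p m + 2 ^ (p.eval m + 1) * y) + 2 : ℕ) : ℤ)| < 2 := by
        exact_mod_cast this
      omega
    · push_cast
      ring
    · have : ((4 * (countWords χ p m + 2 ^ (p.eval m + 1) * y) + 2 : ℕ) : ℝ) ≤ 2 ^ N := by
        rw [← hy]
        exact mul_le_of_le_one_right hN.le h5
      exact_mod_cast this
  -- The total mass is at most 1, so the integer is at most 2^N + 1 < 2^(N+1), with N + 1 = D + 2.
  have h3 := polyTime_extract h2 (coeffExp p + 1) (coeffExp p + 2) (p + 1) (fun m => by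
    obtain ⟨y, δ, hδ, he, hl⟩ := key m
    rw [abs_le] at hδ
    simp only [Polynomial.eval_add, Polynomial.eval_one, Polynomial.eval_ofNat]
    rw [he, show (coeffExp p).eval m + 2 = (coeffExp p).eval m + 1 + 1 from rfl,
      pow_succ 2 ((coeffExp p).eval m + 1)]
    generalize hx : countWords χ p m + 2 ^ (p.eval m + 1) * y = x at hl
    have : (countWords χ p m : ℤ) + 2 ^ (p.eval m + 1) * y = x := by exact_mod_cast hx
    rw [this]
    omega)
  have h4 : (fun m => (h ((coeffExp p + 1).eval m)).re.natAbs / 4 % 2 ^ (p + 1).eval m) =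
      countWords χ p := by
    funext m
    obtain ⟨y, δ, hδ, he, hl⟩ := key m
    rw [abs_le] at hδ
    simp only [Polynomial.eval_add, Polynomial.eval_one]
    have h5 : (h ((coeffExp p).eval m + 1)).re.natAbs / 4 =
        countWords χ p m + 2 ^ (p.eval m + 1) * y := by
      rw [he]
      generalize hx : countWords χ p m + 2 ^ (p.eval m + 1) * y = x
      have : (countWords χ p m : ℤ) + 2 ^ (p.eval m + 1) * y = x := by exact_mod_cast hx
      rw [this]
      omega
    rw [h5, Nat.add_mul_mod_self_left, Nat.mod_eq_of_lt (countWords_lt χ p m)]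
  rw [h4] at h3
  exact h3

end FourierStep

end

theorem theoremt :
    ∃ f : FourierStep.L2Unit,
      FourierStep.FourierPolyTime f ∧
      (¬ FourierStep.classSharpP1 ⊆ FourierStep.classFP1 →
        ¬ FourierStep.FirstStepPolyTime f (fun n => 2 ^ (n ^ 2 + n))) := by
  by_cases hsub : FourierStep.classSharpP1 ⊆ FourierStep.classFP1
  -- The verifier that rejects everything gives a Fourier-computable function, which is all that is
  -- required here.
  · exact ⟨_, FourierStep.fourierPolyTime_witnessFun (fun _ => false) 0
      (FourierStep.polyTime_const _ _ _), fun h => absurd hsub h⟩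
  · obtain ⟨φ, ⟨P, ⟨χ, hχ, hχ'⟩, p, hp⟩, hφ⟩ := Set.not_subset.1 hsub
    refine ⟨_, FourierStep.fourierPolyTime_witnessFun χ p hχ', fun _ h => hφ ?_⟩
    have e : φ = FourierStep.countWords χ p := by
      funext m
      rw [hp, FourierStep.countWords]
      simp only [hχ]
    rw [e]
    exact FourierStep.countWords_mem_classFP1 χ p h
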